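/- Theorem 4.1. For probability measures $P,Q$ on the same measurable space and $\alpha\ge 0$ let $H_\alpha(P\|Q)=\int \max\{\tfrac{dP}{dQ}-\alpha,0\}\,dQ$ be the hockey-stick divergence (if $P\not\ll Q$, the mass of the $Q$-singular part of $P$ is added). Fix positive integers $L_C,L_F$ (context and forecast length), a sequence length $L$ with $L-L_F+1\ge L_C+L_F$, a number $N$ of sequences, a batch size $\Lambda\ge 1$, a parameter dimension $D$, initial parameters $\theta_0\in\mathbb R^D$, a learning rate $\eta>0$, a noise scale $\sigma>0$ and a clipping norm $C>0$. Put $T=L-L_F+1$. A dataset is a set $x=\{x_1,\dots,x_N\}$ of $N$ distinct enumerated sequences in $\mathbb R^L$; $x,x'$ are neighboring ($x\simeq x'$) if they differ in exactly one pair $x_n,x_n'$, and $x_n,x'_n$ differ in exactly one time step. A model consists of functions $f_\theta:\mathbb R^{L_C}\to\mathbb R^{L_F}$ ($\theta\in\mathbb R^D$) and a loss $\mathcal L:\mathbb R^{L_F}\times\mathbb R^{L_F}\to\mathbb R$ such that $\theta\mapsto\mathcal L(f_\theta(c),y)$ is differentiable for all $c,y$. For an integer $1\le\lambda\le\Lambda$,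 the epoch mechanism with deterministic top-level iteration performs $K=\lfloor N\lambda/\Lambda\rfloor$ training steps, starting at $\theta_0$. With $N'=\lfloor\Lambda/\lambda\rfloor$, step $b\in\{1,\dots,K\}$ uses the sequences $x_n$ with $(b-1)N'<n\le bN'$. For each of them, independently, it samples a multiset of start indices in $\{1,\dots,T\}$ by one of two bottom-level schemes: *Poisson sampling* (each index is included independently with probability $\min\{1,\lambda/T\}$) or *sampling with replacement* ($\lambda$ independent uniform indices). Every sampled index $t$ yields the subsequence of length $L_C+L_F$ that starts at position $t$ of $x_n$ after $L_C$ zeros have been prepended to $x_n$; its first $L_C$ entries are the context $c$, its last $L_F$ entries the target $y$, and its gradient $g=\nabla_\theta\mathcal L(f_\theta(c),y)$ at the current parameters is clipped to $g/\max\{1,\|g\|_2/C\}$. The step computes the noisy gradient $\tilde g_b=\frac1\Lambda\big(\sum \text{clipped gradients}+Z_b\big)$ with fresh independent $Z_b\sim\mathcal N(0,\sigma^2C^2 I)$, and replaces $\theta$ by $\theta-\eta\tilde g_b$. The output of the epoch is $(\tilde g_1,\dots,\tilde g_K)\in\mathbb R^{K\times D}$; its distribution on the dataset $x$ with the model $m=(f,\mathcal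 L)$ is denoted $M^{(\lambda)}_{m,x}$. Probability distributions $(P,Q)$ on a common measurable space are a tight dominating pair of the epoch mechanism with parameter $\lambda$ if $\sup_{m}\sup_{x\simeq x'}H_\alpha(M^{(\lambda)}_{m,x}\|M^{(\lambda)}_{m,x'})=H_\alpha(P\|Q)$ for all $\alpha\ge 0$. Fix either of the two bottom-level schemes and let $(P^*(\lambda),Q^*(\lambda))$ be a tight dominating pair of the epoch mechanism with parameter $\lambda$, for every $\lambda\in\{1,\dots,\Lambda\}$. Then, for every $\alpha\ge 0$, $H_\alpha(P^*(\lambda)\|Q^*(\lambda))$ is minimized over $\lambda\in\{1,\dots,\Lambda\}$ at $\lambda=1$. -/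

import Mathlib

open MeasureTheory ProbabilityTheory
open scoped ENNReal NNReal

noncomputable section

namespace StructuredSubsampling

/-! ### Hockey-stick divergence and dominating pairs -/

/-- The hockey-stick divergence `H_α(P ‖ Q) = ∫ max {dP/dQ - α, 0} dQ`, where the part of `P` that
is singular with respect to `Q` (on which `dP/dQ = ∞`) contributes its whole mass. For `P ≪ Q` the
second summand is `0`. (Subtraction in `ℝ≥0∞` is truncated at `0`.) -/
def hockeyStick {O : Type*} [MeasurableSpace O] (α : ℝ≥0) (P Q : Measure O) : ℝ≥0∞ :=
  (∫⁻ o, (P.rnDeriv Q o - (α : ℝ≥0∞)) ∂Q) + P.singularPart Q Set.univ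

/-- The privacy profile `α ↦ sup_{x ≃ x'} H_α(M_x ‖ M_{x'})` of a mechanism `M` under the neighboring
relation `R`. The mechanism may depend on a parameter `i : ι` about which nothing is assumed, so that
the supremum is also over `i`; both datasets are processed with the same parameter. -/
def privacyProfile {ι X O : Type*} [MeasurableSpace O] (M : ι → X → Measure O)
    (R : X → X → Prop) (α : ℝ≥0) : ℝ≥0∞ :=
  ⨆ (i : ι) (x : X) (x' : X) (_ : R x x'), hockeyStick α (M i x) (M i x')

/-- The probability distributions `(P, Q)` are a tight dominating pair for the mechanism `M` under the
neighboring relation `R`. -/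
def IsTightDominatingPair {ι X O Ω : Type*} [MeasurableSpace O] [MeasurableSpace Ω]
    (M : ι → X → Measure O) (R : X → X → Prop) (P Q : Measure Ω) : Prop :=
  IsProbabilityMeasure P ∧ IsProbabilityMeasure Q ∧
    ∀ α : ℝ≥0, privacyProfile M R α = hockeyStick α P Q

/-! ### Datasets of time series -/

/-- A dataset: a set of `N` time series of length `L`, with an enumeration `x_1, …, x_N`. -/
abbrev Dataset (N L : ℕ) : Type := Fin N ↪ (Fin L → ℝ)

/-- `1`-event-level neighboring datasets: they differ in a single pair of sequences, and these two
sequences differ in a single time step. -/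
def EventNeighboring {N L : ℕ} (x x' : Dataset N L) : Prop :=
  ∃ (n : Fin N) (t : Fin L), x n t ≠ x' n t ∧ (∀ s, s ≠ t → x n s = x' n s) ∧
    ∀ m, m ≠ n → x m = x' m

/-- The sequence `a`, preceded by `LC` zeros (positions are counted from `0`). -/
def prependZeros {L : ℕ} (LC : ℕ) (a : Fin L → ℝ) (s : ℕ) : ℝ :=
  if h : LC ≤ s ∧ s - LC < L then a ⟨s - LC, h.2⟩ else 0

/-- The number `T = L - LF + 1` of start indices of subsequences (used for `LF ≤ L`). -/
abbrev numStarts (L LF : ℕ) : ℕ := L - LF + 1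

/-- Context window (first `LC` entries) of the length-`(LC + LF)` subsequence of the zero-padded
sequence that starts at position `t`. -/
def contextWindow {L : ℕ} (LC : ℕ) (a : Fin L → ℝ) (t : ℕ) : Fin LC → ℝ :=
  fun i => prependZeros LC a (t + i)

/-- Forecast window (last `LF` entries) of the length-`(LC + LF)` subsequence of the zero-padded
sequence that starts at position `t`. -/
def forecastWindow {L : ℕ} (LC LF : ℕ) (a : Fin L → ℝ) (t : ℕ) : Fin LF → ℝ :=
  fun j => prependZeros LC a (t + LC + j)

/-! ### Bottom-level sampling: the multiset of sampled start indices of one sequence -/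

/-- The two bottom-level sampling schemes. -/
inductive BottomLevel
  | poisson
  | withReplacement

/-- Poisson sampling at rate `r`: every element of `Fin T` is included independently with
probability `r`. -/
def poissonSubset (T : ℕ) (r : ℝ≥0) (hr : r ≤ 1) : PMF (Finset (Fin T)) :=
  PMF.ofFintype (fun S => ∏ t : Fin T, if t ∈ S then (r : ℝ≥0∞) else 1 - (r : ℝ≥0∞)) <| by
    have h1 : (r : ℝ≥0∞) + (1 - (r : ℝ≥0∞)) = 1 :=
      add_tsub_cancel_of_le (by exact_mod_cast hr)
    have h2 := Finset.prod_add (fun _ : Fin T => (r : ℝ≥0∞)) (fun _ => 1 - (r : ℝ≥0∞)) Finset.univ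
    simp only [h1, Finset.prod_const_one, Finset.powerset_univ] at h2
    refine Eq.trans ?_ h2.symm
    refine Finset.sum_congr rfl fun S _ => ?_
    rw [← Finset.prod_mul_prod_compl S, ← Finset.compl_eq_univ_sdiff]
    congr 1
    · exact Finset.prod_congr rfl fun t ht => by simp [ht]
    · exact Finset.prod_congr rfl fun t ht => by simp [Finset.mem_compl.mp ht]

/-- The distribution of the multiset of sampled start indices, for `T` available start indices and
`lam` (expected) subsequences. -/
def BottomLevel.sample (T : ℕ) [NeZero T] (lam : ℕ) : BottomLevel → PMF (Multiset (Fin T))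
  | .poisson =>
      (poissonSubset T (min 1 ((lam : ℝ≥0) / (T : ℝ≥0))) (min_le_left _ _)).map Finset.val
  | .withReplacement =>
      (PMF.uniformOfFintype (Fin lam → Fin T)).map fun τ => Finset.univ.val.map τ

/-- Multisets of start indices carry the discrete σ-algebra. -/
instance instMeasurableSpaceMultisetFin (T : ℕ) : MeasurableSpace (Multiset (Fin T)) := ⊤

instance instDiscreteMeasurableSpaceMultisetFin (T : ℕ) :
    DiscreteMeasurableSpace (Multiset (Fin T)) := ⟨fun _ => trivial⟩

/-! ### The model -/

/-- The space of model parameters and of gradients. -/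
abbrev Params (D : ℕ) : Type := EuclideanSpace ℝ (Fin D)

/-- A parametric forecasting model `f_θ` with a loss, such that the loss of every forecast is
differentiable in the parameters `θ`. -/
structure ForecastModel (D LC LF : ℕ) where
  /-- the forecast `f_θ(y_C)` -/
  predict : Params D → (Fin LC → ℝ) → (Fin LF → ℝ)
  /-- the loss of a forecast, given the true values -/
  loss : (Fin LF → ℝ) → (Fin LF → ℝ) → ℝ
  differentiable : ∀ c y, Differentiable ℝ fun θ => loss (predict θ c) y

/-- The gradient `∇_θ loss(f_θ(c), y)`. -/
def ForecastModel.grad {D LC LF : ℕ} (m : ForecastModel D LC LF) (θ : Params D)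
    (c : Fin LC → ℝ) (y : Fin LF → ℝ) : Params D :=
  gradient (fun θ' => m.loss (m.predict θ' c) y) θ

/-- Gradient clipping `g / max {1, ‖g‖₂ / C}`. -/
def clip {D : ℕ} (C : ℝ) (g : Params D) : Params D :=
  (max 1 (‖g‖ / C))⁻¹ • g

/-! ### The epoch mechanism -/

/-- Public inputs of a training epoch, apart from the data, the model and the (expected) number `lam`
of subsequences per sequence. -/
structure EpochConfig where
  /-- number of sequences -/
  N : ℕ
  /-- length of the sequences -/
  L : ℕ
  /-- context length -/
  LC : ℕ
  /-- forecast length -/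
  LF : ℕ
  /-- number of model parameters -/
  D : ℕ
  /-- (expected) batch size -/
  batchSize : ℕ
  /-- noise scale -/
  σ : ℝ
  /-- clipping norm -/
  C : ℝ
  /-- learning rate -/
  η : ℝ
  /-- initial parameters -/
  θ₀ : Params D

namespace EpochConfig

variable (cfg : EpochConfig) (lam : ℕ)

/-- The number `T` of start indices. -/
abbrev T : ℕ := numStarts cfg.L cfg.LF

/-- The number `⌊N * lam / Λ⌋` of training steps in an epoch, where `Λ` is the batch size. -/
def numSteps : ℕ := cfg.N * lam / cfg.batchSize

/-- The number `N' = ⌊Λ / lam⌋` of sequences per batch, where `Λ` is the batch size. -/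
def seqsPerBatch : ℕ := cfg.batchSize / lam

theorem index_lt {lam : ℕ} (b : Fin (cfg.numSteps lam)) (j : Fin (cfg.seqsPerBatch lam)) :
    b * cfg.seqsPerBatch lam + j < cfg.N := by
  have hb := b.2
  have hj := j.2
  have hlam : 0 < lam := by
    rcases Nat.eq_zero_or_pos lam with h | h
    · subst h
      simp [numSteps] at hb
    · exact h
  have h1 : (b : ℕ) * cfg.seqsPerBatch lam + j < cfg.numSteps lam * cfg.seqsPerBatch lam := by
    calc (b : ℕ) * cfg.seqsPerBatch lam + j
        < (b : ℕ) * cfg.seqsPerBatch lam + cfg.seqsPerBatch lam := by omega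
      _ = ((b : ℕ) + 1) * cfg.seqsPerBatch lam := by ring
      _ ≤ _ := Nat.mul_le_mul_right _ hb
  refine lt_of_lt_of_le h1 (Nat.le_of_mul_le_mul_right ?_ hlam)
  calc cfg.numSteps lam * cfg.seqsPerBatch lam * lam
      = cfg.numSteps lam * (cfg.batchSize / lam * lam) := by rw [seqsPerBatch, mul_assoc]
    _ ≤ cfg.numSteps lam * cfg.batchSize := Nat.mul_le_mul_left _ (Nat.div_mul_le_self _ _)
    _ ≤ cfg.N * lam := Nat.div_mul_le_self _ _

/-- Deterministic top-level iteration: the index of the `j`-th sequence in the `b`-th batch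
(everything counted from `0`). -/
def topLevel {lam : ℕ} (b : Fin (cfg.numSteps lam)) (j : Fin (cfg.seqsPerBatch lam)) : Fin cfg.N :=
  ⟨b * cfg.seqsPerBatch lam + j, cfg.index_lt b j⟩

/-- The randomness of one training step: the sampled start indices of every sequence in the batch,
and a standard Gaussian vector. -/
abbrev StepRandomness : Type :=
  (Fin (cfg.seqsPerBatch lam) → Multiset (Fin cfg.T)) × Params cfg.D

/-- The distribution of the randomness of one training step. -/
def stepRandomnessLaw (S : BottomLevel) : Measure (cfg.StepRandomness lam) :=
  (Measure.pi fun _ => (S.sample cfg.T lam).toMeasure).prod (stdGaussian (Params cfg.D))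

variable {lam}

/-- The noisy gradient `Λ⁻¹ (∑ clipped gradients of the sampled subsequences + 𝒩(0, σ² C² I))` of the
`b`-th training step at the parameters `θ`, as a function of the step's randomness `ω`. -/
def noisyGradient (m : ForecastModel cfg.D cfg.LC cfg.LF) (x : Dataset cfg.N cfg.L)
    (b : Fin (cfg.numSteps lam)) (θ : Params cfg.D) (ω : cfg.StepRandomness lam) : Params cfg.D :=
  (1 / (cfg.batchSize : ℝ)) •
    ((∑ j : Fin (cfg.seqsPerBatch lam), ((ω.1 j).map fun t : Fin cfg.T =>
        clip cfg.C (m.grad θ (contextWindow cfg.LC (x (cfg.topLevel b j)) t)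
          (forecastWindow cfg.LC cfg.LF (x (cfg.topLevel b j)) t))).sum)
      + (cfg.σ * cfg.C) • ω.2)

/-- The model parameters after `k` training steps, as a function of the epoch's randomness. -/
def iterate (m : ForecastModel cfg.D cfg.LC cfg.LF) (x : Dataset cfg.N cfg.L)
    (ω : Fin (cfg.numSteps lam) → cfg.StepRandomness lam) : ℕ → Params cfg.D
  | 0 => cfg.θ₀
  | k + 1 =>
    if h : k < cfg.numSteps lam then
      iterate m x ω k - cfg.η • cfg.noisyGradient m x ⟨k, h⟩ (iterate m x ω k) (ω ⟨k, h⟩)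
    else iterate m x ω k

/-- The output of the epoch (learning without hidden states): the noisy gradients used in all its
training steps. -/
def output (m : ForecastModel cfg.D cfg.LC cfg.LF) (x : Dataset cfg.N cfg.L)
    (ω : Fin (cfg.numSteps lam) → cfg.StepRandomness lam) : Fin (cfg.numSteps lam) → Params cfg.D :=
  fun b => cfg.noisyGradient m x b (cfg.iterate m x ω b) (ω b)

/-- The epoch mechanism: the distribution `M_x` of the output of an epoch on the dataset `x`, when
training the model `m` with bottom-level sampling scheme `S` and `lam` (expected) subsequences. All
the sampling and all the noise is independent. -/
def epoch (lam : ℕ) (S : BottomLevel) (m : ForecastModel cfg.D cfg.LC cfg.LF)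
    (x : Dataset cfg.N cfg.L) : Measure (Fin (cfg.numSteps lam) → Params cfg.D) :=
  (Measure.pi fun _ : Fin (cfg.numSteps lam) => cfg.stepRandomnessLaw lam S).map (cfg.output m x)

end EpochConfig

end StructuredSubsampling

end

/-! The hockey-stick divergence is the best value of `P B - α * Q B` over events `B`. It therefore
suffices to bound the value of every event for one subsequence per sequence by the value of one
concrete event for `lam` subsequences; the optimal event for `lam` is never needed.

Upper bound at `lam = 1`: deterministic iteration uses the changed sequence in at most one step.
With all other randomness frozen, the epoch is a common function of that step's noisy gradient
(`epoch_le_of_step`), and two mixtures of isotropic Gaussians remain to be compared. By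
`neymanPearson_mixture` their difference on any event is at most that of mixtures on a line on a
half-line, if every pair of opposing means is at least as far apart there. The worst gradients are
thus collinear: `C` against `-C` where the window contains the changed time step, a common `k₀`
elsewhere (`extremalValue`).

Monotonicity: on these gradients further subsequences only help a half-line test. Poisson sums move
apart as the rate grows; with replacement, the first draw is kept and a shifted threshold absorbs
the others.

Lower bound at `lam`: `spikeModel` on `spikeDataset` realizes the extremal gradients, so the privacy
profile is at least the extremal value. When the two output distributions coincide, the bound `1 -
α`, valid for every profile, suffices. -/

noncomputable section

namespace StructuredSubsampling

/-! ### One-dimensional Neyman–Pearson lemma for Gaussians -/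

/-- The squared scale, as a variance. -/
def scaleVar (s : ℝ) : ℝ≥0 := .mk (s ^ 2) (sq_nonneg s)

theorem scaleVar_ne_zero {s : ℝ} (hs : 0 < s) : scaleVar s ≠ 0 := by
  intro h
  have : s ^ 2 = 0 := congrArg NNReal.toReal h
  exact hs.ne' (pow_eq_zero_iff two_ne_zero |>.1 this)

theorem gaussianReal_real_apply (m : ℝ) {s : ℝ} (hs : 0 < s) {A : Set ℝ} :
    (gaussianReal m (scaleVar s)).real A = ∫ t in A, gaussianPDFReal m (scaleVar s) t := by
  rw [Measure.real, gaussianReal_apply_eq_integral _ (scaleVar_ne_zero hs),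
    ENNReal.toReal_ofReal (integral_nonneg fun t => gaussianPDFReal_nonneg _ _ _)]

/-- The ratio of two Gaussian densities is an exponential. -/
theorem gaussianPDFReal_eq_mul_exp (x y : ℝ) {s : ℝ} (hs : 0 < s) (t : ℝ) :
    gaussianPDFReal x (scaleVar s) t =
      gaussianPDFReal y (scaleVar s) t *
        Real.exp ((x - y) * (2 * t - x - y) / (2 * s ^ 2)) := by
  have hv : ((scaleVar s : ℝ≥0) : ℝ) = s ^ 2 := rfl
  simp only [gaussianPDFReal, hv]
  have hs' : s ≠ 0 := hs.ne'
  have h : -(t - x) ^ 2 / (2 * s ^ 2) =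
      -(t - y) ^ 2 / (2 * s ^ 2) + (x - y) * (2 * t - x - y) / (2 * s ^ 2) := by
    field_simp
    ring
  rw [h, Real.exp_add, ← mul_assoc]

/-- Since `y ≤ x`, the likelihood ratio is monotone. The weighted density difference vanishes at
`τ`, so it is nonpositive to the left and nonnegative to the right of it, and no event collects more
than the half-line. -/
theorem neymanPearson_gaussianReal {c₁ c₂ x y s τ : ℝ} (hs : 0 < s) (hc₁ : 0 ≤ c₁)
    (hxy : y ≤ x)
    (hτ : c₁ * gaussianPDFReal x (scaleVar s) τ = c₂ * gaussianPDFReal y (scaleVar s) τ)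
    {A : Set ℝ} (hA : MeasurableSet A) :
    c₁ * (gaussianReal x (scaleVar s)).real A - c₂ * (gaussianReal y (scaleVar s)).real A ≤
      c₁ * (gaussianReal x (scaleVar s)).real (Set.Ici τ)
        - c₂ * (gaussianReal y (scaleVar s)).real (Set.Ici τ) := by
  have hv := scaleVar_ne_zero hs
  have hx := integrable_gaussianPDFReal x (scaleVar s)
  have hy := integrable_gaussianPDFReal y (scaleVar s)
  have key : ∀ B : Set ℝ, c₁ * (gaussianReal x (scaleVar s)).real B
      - c₂ * (gaussianReal y (scaleVar s)).real B =
      ∫ t in B, (c₁ * gaussianPDFReal x (scaleVar s) t - c₂ * gaussianPDFReal y (scaleVar s) t) := by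
    intro B
    rw [integral_sub (hx.const_mul _).integrableOn (hy.const_mul _).integrableOn,
      integral_const_mul, integral_const_mul, gaussianReal_real_apply _ hs,
      gaussianReal_real_apply _ hs]
  have hint : Integrable fun t => c₁ * gaussianPDFReal x (scaleVar s) t
      - c₂ * gaussianPDFReal y (scaleVar s) t := (hx.const_mul _).sub (hy.const_mul _)
  have hc₂ : c₂ = c₁ * Real.exp ((x - y) * (2 * τ - x - y) / (2 * s ^ 2)) := by
    rw [gaussianPDFReal_eq_mul_exp x y hs] at hτ
    have := gaussianPDFReal_pos y _ τ hv
    exact mul_right_cancel₀ this.ne' (by linarith)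
  have hmono : ∀ t t', t ≤ t' → Real.exp ((x - y) * (2 * t - x - y) / (2 * s ^ 2)) ≤
      Real.exp ((x - y) * (2 * t' - x - y) / (2 * s ^ 2)) := by
    intro t t' h
    have : 0 ≤ x - y := sub_nonneg.2 hxy
    gcongr
  have hdiff : ∀ t, c₁ * gaussianPDFReal x (scaleVar s) t - c₂ * gaussianPDFReal y (scaleVar s) t =
      c₁ * gaussianPDFReal y (scaleVar s) t *
        (Real.exp ((x - y) * (2 * t - x - y) / (2 * s ^ 2)) -
          Real.exp ((x - y) * (2 * τ - x - y) / (2 * s ^ 2))) := by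
    intro t
    rw [gaussianPDFReal_eq_mul_exp x y hs, hc₂]
    ring
  rw [key, key, ← integral_indicator hA, ← integral_indicator measurableSet_Ici]
  refine integral_mono (hint.indicator hA) (hint.indicator measurableSet_Ici) fun t => ?_
  have hp : 0 ≤ c₁ * gaussianPDFReal y (scaleVar s) t :=
    mul_nonneg hc₁ (gaussianPDFReal_nonneg _ _ _)
  simp only [Set.indicator, hdiff, Set.mem_Ici]
  split_ifs with h1 h2 h2
  · exact le_rfl
  · exact mul_nonpos_of_nonneg_of_nonpos hp (sub_nonpos.2 (hmono _ _ (not_le.1 h2).le))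
  · exact mul_nonneg hp (sub_nonneg.2 (hmono _ _ h2))
  · exact le_rfl

/-! ### Isotropic Gaussians -/

variable {E : Type*} [NormedAddCommGroup E] [InnerProductSpace ℝ E] [FiniteDimensional ℝ E]
  [MeasurableSpace E] [BorelSpace E]

/-- The isotropic Gaussian measure with mean `u` and standard deviation `s`. -/
def isoGaussian (s : ℝ) (u : E) : Measure E := (stdGaussian E).map fun z => u + s • z

instance (s : ℝ) (u : E) : IsProbabilityMeasure (isoGaussian s u) :=
  Measure.isProbabilityMeasure_map (by fun_prop)

theorem gaussianReal_eq_map (m s : ℝ) :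
    gaussianReal m (scaleVar s) = (gaussianReal 0 1).map fun ξ => m + s * ξ := by
  have h : (fun ξ : ℝ => m + s * ξ) = (fun ξ => m + ξ) ∘ fun ξ => s * ξ := rfl
  rw [h, ← Measure.map_map (by fun_prop) (by fun_prop), gaussianReal_map_const_mul,
    gaussianReal_map_const_add]
  simp [scaleVar]

open scoped RealInnerProductSpace

theorem map_inner_stdGaussian {e : E} (he : ‖e‖ = 1) :
    (stdGaussian E).map (fun z => ⟪z, e⟫) = gaussianReal 0 1 := by
  refine Measure.ext_of_charFun ?_
  ext t
  rw [charFun_apply_real, integral_map (by fun_prop) (by fun_prop), charFun_gaussianReal]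
  have := charFun_stdGaussian (E := E) (t • e)
  rw [charFun_apply] at this
  simp only [real_inner_smul_right, norm_smul, he, mul_one] at this
  push_cast at this
  rw [this]
  simp [← Complex.ofReal_pow]
  ring_nf

/-- A standard Gaussian vector is the sum of a standard Gaussian multiple of `h` and an independent
Gaussian vector, if `‖h‖ ≤ 1`. -/
theorem map_prod_stdGaussian {h : E} (hh : ‖h‖ ≤ 1) :
    ((gaussianReal 0 1).prod (stdGaussian E)).map
      (fun p => p.1 • h + (p.2 - (1 / (1 + √(1 - ‖h‖ ^ 2)) * ⟪h, p.2⟫) • h)) =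
      stdGaussian E := by
  -- This `c` solves `2 * c - c ^ 2 * ‖h‖ ^ 2 = 1`, which gives `z - (c * ⟪h, z⟫) • h` the
  -- covariance `I - h hᵀ`. This form of the root also makes sense at `h = 0`.
  set c := 1 / (1 + √(1 - ‖h‖ ^ 2)) with hc
  have hq : √(1 - ‖h‖ ^ 2) ^ 2 = 1 - ‖h‖ ^ 2 := Real.sq_sqrt (by nlinarith [norm_nonneg h])
  have hq0 := Real.sqrt_nonneg (1 - ‖h‖ ^ 2)
  have hc2 : 2 * c - c ^ 2 * ‖h‖ ^ 2 = 1 := by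
    have : ‖h‖ ^ 2 = 1 - √(1 - ‖h‖ ^ 2) ^ 2 := by linarith
    rw [this, hc]
    field_simp
    rw [hq]
    nlinarith
  have e1 : (fun p : ℝ × E => p.1 • h + (p.2 - (c * ⟪h, p.2⟫) • h)) =
      (fun p : E × E => p.1 + p.2) ∘ Prod.map (fun ξ : ℝ => ξ • h)
        (fun z : E => z - (c * ⟪h, z⟫) • h) := rfl
  have m1 : Measurable (fun ξ : ℝ => ξ • h) := by fun_prop
  have m2 : Measurable (fun z : E => z - (c * ⟪h, z⟫) • h) := by fun_prop
  rw [e1, ← Measure.map_map (by fun_prop) (m1.prodMap m2), ← Measure.map_prod_map _ _ m1 m2]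
  have := Measure.isProbabilityMeasure_map (μ := gaussianReal 0 1) m1.aemeasurable
  have := Measure.isProbabilityMeasure_map (μ := stdGaussian E) m2.aemeasurable
  refine Measure.ext_of_charFun ?_
  rw [charFun_map_add_prod_eq_mul]
  ext t
  have a1 : charFun ((gaussianReal 0 1).map fun ξ : ℝ => ξ • h) t =
      charFun (gaussianReal 0 1) ⟪h, t⟫ := by
    rw [charFun_apply, charFun_apply_real, integral_map (by fun_prop) (by fun_prop)]
    simp only [real_inner_smul_left, Complex.ofReal_mul]
    simp_rw [mul_comm]
  have a2 : charFun ((stdGaussian E).map fun z : E => z - (c * ⟪h, z⟫) • h) t =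
      charFun (stdGaussian E) (t - (c * ⟪h, t⟫) • h) := by
    rw [charFun_apply, charFun_apply, integral_map (by fun_prop) (by fun_prop)]
    congr 1
    ext z
    congr 3
    simp only [inner_sub_left, inner_sub_right, real_inner_smul_left, real_inner_smul_right]
    rw [real_inner_comm z h]
    ring
  rw [Pi.mul_apply, a1, a2, charFun_gaussianReal, charFun_stdGaussian, charFun_stdGaussian,
    ← Complex.exp_add]
  have hn : ‖t - (c * ⟪h, t⟫) • h‖ ^ 2 = ‖t‖ ^ 2 - ⟪h, t⟫ ^ 2 := by
    rw [norm_sub_sq_real, norm_smul, real_inner_smul_right, mul_pow, Real.norm_eq_abs, sq_abs,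
      real_inner_comm h t]
    linear_combination (-⟪h, t⟫ ^ 2) * hc2
  congr 1
  rw [← Complex.ofReal_pow, ← Complex.ofReal_pow, hn]
  push_cast
  simp
  ring

/-- An isotropic Gaussian as a randomized image of a Gaussian on the line, where the randomization
does not depend on the mean `m`. -/
theorem isoGaussian_real_eq_integral {h : E} (hh : ‖h‖ ≤ 1) (s m y : ℝ) (w : E) {A : Set E}
    (hA : MeasurableSet A) :
    (isoGaussian s (w + (m - y) • h)).real A =
      ∫ z, (gaussianReal m (scaleVar s)).real
        {r | w + (r - y) • h + s • (z - (1 / (1 + √(1 - ‖h‖ ^ 2)) * ⟪h, z⟫) • h) ∈ A}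
          ∂(stdGaussian E) := by
  set c := 1 / (1 + √(1 - ‖h‖ ^ 2)) with hc
  have hmeas : MeasurableSet {p : ℝ × E | w + (p.1 - y) • h + s • (p.2 - (c * ⟪h, p.2⟫) • h) ∈ A} :=
    (by fun_prop : Measurable fun p : ℝ × E =>
      w + (p.1 - y) • h + s • (p.2 - (c * ⟪h, p.2⟫) • h)) hA
  have h1 : isoGaussian s (w + (m - y) • h) =
      ((gaussianReal m (scaleVar s)).prod (stdGaussian E)).map
        (fun p => w + (p.1 - y) • h + s • (p.2 - (c * ⟪h, p.2⟫) • h)) := by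
    have h2 := Measure.map_prod_map (gaussianReal 0 1) (stdGaussian E)
      (f := fun ξ : ℝ => m + s * ξ) (g := id) (by fun_prop) measurable_id
    rw [Measure.map_id, ← gaussianReal_eq_map] at h2
    rw [h2, Measure.map_map (by fun_prop) (by fun_prop), isoGaussian]
    conv_lhs => rw [← map_prod_stdGaussian hh]
    rw [Measure.map_map (by fun_prop) (by fun_prop)]
    congr 1
    ext p
    simp only [Function.comp, Prod.map, id, hc]
    module
  rw [Measure.real, h1, Measure.map_apply (by fun_prop) hA, Measure.prod_apply_symm
    (measurableSet_preimage (by fun_prop) hA)]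
  simp only [Measure.real]
  rw [integral_toReal]
  · rfl
  · exact (measurable_measure_prodMk_right hmeas).aemeasurable
  · exact .of_forall fun z => measure_lt_top _ _

/-- The Neyman–Pearson bound for two isotropic Gaussians, in terms of Gaussians on the line whose
distance is at least as large. -/
theorem neymanPearson_isoGaussian {c₁ c₂ x y s τ : ℝ} (hs : 0 < s) (hc₁ : 0 ≤ c₁)
    (hτ : c₁ * gaussianPDFReal x (scaleVar s) τ = c₂ * gaussianPDFReal y (scaleVar s) τ)
    {u w : E} (hd : ‖u - w‖ ≤ x - y) {A : Set E} (hA : MeasurableSet A) :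
    c₁ * (isoGaussian s u).real A - c₂ * (isoGaussian s w).real A ≤
      c₁ * (gaussianReal x (scaleVar s)).real (Set.Ici τ)
        - c₂ * (gaussianReal y (scaleVar s)).real (Set.Ici τ) := by
  have hxy : y ≤ x := sub_nonneg.1 ((norm_nonneg _).trans hd)
  -- Moving the mean on the line from `y` to `x` moves the mean in `E` from `w` to `u`; the distance
  -- hypothesis becomes `‖h‖ ≤ 1`. If `x = y` the inverse is `0`, and `u = w`.
  set h : E := (x - y)⁻¹ • (u - w) with hh
  have hn : ‖h‖ ≤ 1 := by
    rw [hh, norm_smul, norm_inv, Real.norm_eq_abs, abs_of_nonneg (sub_nonneg.2 hxy)]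
    exact inv_mul_le_one_of_le₀ hd (sub_nonneg.2 hxy)
  have hu : u = w + (x - y) • h := by
    rcases eq_or_ne (x - y) 0 with h0 | h0
    · rw [h0] at hd ⊢
      have : u - w = 0 := norm_le_zero_iff.1 hd
      simp [sub_eq_zero.1 this]
    · rw [hh, smul_smul, mul_inv_cancel₀ h0]
      simp
  have hw : w = w + (y - y) • h := by simp
  have h1 := isoGaussian_real_eq_integral hn s x y w hA
  have h2 := isoGaussian_real_eq_integral hn s y y w hA
  rw [← hu] at h1
  rw [← hw] at h2
  rw [h1, h2]
  set c := 1 / (1 + √(1 - ‖h‖ ^ 2)) with hc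
  have hmeas : MeasurableSet {p : ℝ × E | w + (p.1 - y) • h + s • (p.2 - (c * ⟪h, p.2⟫) • h) ∈ A} :=
    (by fun_prop : Measurable fun p : ℝ × E =>
      w + (p.1 - y) • h + s • (p.2 - (c * ⟪h, p.2⟫) • h)) hA
  have hint : ∀ m, Integrable (fun z => (gaussianReal m (scaleVar s)).real
        {r | w + (r - y) • h + s • (z - (c * ⟪h, z⟫) • h) ∈ A}) (stdGaussian E) := by
    intro m
    refine Integrable.of_bound (C := 1) ?_ (.of_forall fun z => ?_)
    · exact (measurable_measure_prodMk_right hmeas).ennreal_toReal.aestronglyMeasurable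
    · rw [Real.norm_eq_abs, abs_of_nonneg measureReal_nonneg]
      exact measureReal_le_one
  rw [← integral_const_mul, ← integral_const_mul,
    ← integral_sub ((hint x).const_mul _) ((hint y).const_mul _)]
  refine (integral_mono (((hint x).const_mul _).sub ((hint y).const_mul _))
    (integrable_const (c₁ * (gaussianReal x (scaleVar s)).real (Set.Ici τ)
        - c₂ * (gaussianReal y (scaleVar s)).real (Set.Ici τ))) fun z => ?_).trans_eq (by simp)
  -- For fixed `z` the event is a subset of the line, the same one for both means.
  refine neymanPearson_gaussianReal hs hc₁ hxy hτ ?_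
  exact (by fun_prop : Measurable fun r : ℝ => w + (r - y) • h + s • (z - (c * ⟪h, z⟫) • h)) hA

/-- The Neyman–Pearson bound for mixtures of isotropic Gaussians. -/
theorem neymanPearson_mixture {ι κ : Type*} [Fintype ι] [Fintype κ] {a : ι → ℝ} {b : κ → ℝ}
    {x : ι → ℝ} {y : κ → ℝ} {s τ : ℝ} (hs : 0 < s) (ha : ∀ i, 0 ≤ a i) (hb : ∀ j, 0 ≤ b j)
    (hτ : ∑ i, a i * gaussianPDFReal (x i) (scaleVar s) τ =
      ∑ j, b j * gaussianPDFReal (y j) (scaleVar s) τ)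
    {u : ι → E} {w : κ → E} (hd : ∀ i j, ‖u i - w j‖ ≤ x i - y j) {A : Set E}
    (hA : MeasurableSet A) :
    ∑ i, a i * (isoGaussian s (u i)).real A - ∑ j, b j * (isoGaussian s (w j)).real A ≤
      ∑ i, a i * (gaussianReal (x i) (scaleVar s)).real (Set.Ici τ)
        - ∑ j, b j * (gaussianReal (y j) (scaleVar s)).real (Set.Ici τ) := by
  set p : ι → ℝ := fun i => gaussianPDFReal (x i) (scaleVar s) τ with hp
  set q : κ → ℝ := fun j => gaussianPDFReal (y j) (scaleVar s) τ with hq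
  have hp0 : ∀ i, 0 < p i := fun i => gaussianPDFReal_pos _ _ _ (scaleVar_ne_zero hs)
  have hq0 : ∀ j, 0 < q j := fun j => gaussianPDFReal_pos _ _ _ (scaleVar_ne_zero hs)
  -- Multiplying by the common mixture density at `τ` splits the difference into pairs with weights
  -- `a i * (b j * q j)` and `b j * (a i * p i)`. Each pair balances at `τ` by itself, so one
  -- threshold serves them all.
  have hsum : ∀ (f : ι → ℝ) (g : κ → ℝ),
      (∑ i, a i * p i) * (∑ i, a i * f i - ∑ j, b j * g j) =
        ∑ i, ∑ j, ((a i * (b j * q j)) * f i - (b j * (a i * p i)) * g j) := by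
    intro f g
    simp_rw [Finset.sum_sub_distrib]
    rw [mul_sub]
    congr 1
    · rw [hτ, Finset.sum_mul_sum, Finset.sum_comm]
      exact Finset.sum_congr rfl fun i _ => Finset.sum_congr rfl fun j _ => by ring
    · rw [Finset.sum_mul_sum]
      exact Finset.sum_congr rfl fun i _ => Finset.sum_congr rfl fun j _ => by ring
  rcases (Finset.sum_nonneg fun i _ => mul_nonneg (ha i) (hp0 i).le :
    0 ≤ ∑ i, a i * p i).eq_or_lt with h0 | h0
  · have ha0 : ∀ i, a i = 0 := fun i => by
      have := (Finset.sum_eq_zero_iff_of_nonneg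
        fun i _ => mul_nonneg (ha i) (hp0 i).le).1 h0.symm i (Finset.mem_univ _)
      exact (mul_eq_zero.1 this).resolve_right (hp0 i).ne'
    have hb0 : ∀ j, b j = 0 := fun j => by
      have := (Finset.sum_eq_zero_iff_of_nonneg
        fun j _ => mul_nonneg (hb j) (hq0 j).le).1 (h0.trans hτ).symm j (Finset.mem_univ _)
      exact (mul_eq_zero.1 this).resolve_right (hq0 j).ne'
    simp [ha0, hb0]
  · refine le_of_mul_le_mul_left ?_ h0
    rw [hsum, hsum]
    refine Finset.sum_le_sum fun i _ => Finset.sum_le_sum fun j _ => ?_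
    refine neymanPearson_isoGaussian hs (mul_nonneg (ha i) (mul_nonneg (hb j) (hq0 j).le)) ?_
      (hd i j) hA
    simp only [hp, hq]
    ring

end StructuredSubsampling

namespace StructuredSubsampling

/-! ### Existence of the optimal threshold -/

theorem gaussianPDFReal_neg_arg (x t : ℝ) (v : ℝ≥0) :
    gaussianPDFReal x v (-t) = gaussianPDFReal (-x) v t := by
  simp only [gaussianPDFReal]
  congr 3
  ring

/-- Far to the right, a component outweighs all components with smaller means. -/
theorem exists_sum_gaussianPDFReal_le {ι κ : Type*} [Fintype ι] [Fintype κ] {a : ι → ℝ} {b : κ → ℝ}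
    {x : ι → ℝ} {y : κ → ℝ} {s : ℝ} (hs : 0 < s) (ha : ∀ i, 0 ≤ a i)
    {i₀ : ι} (hai : 0 < a i₀) (hi : ∀ j, y j < x i₀) :
    ∃ τ, ∑ j, b j * gaussianPDFReal (y j) (scaleVar s) τ ≤
      ∑ i, a i * gaussianPDFReal (x i) (scaleVar s) τ := by
  have hlim : Filter.Tendsto (fun τ => ∑ j, b j *
      Real.exp ((y j - x i₀) * (2 * τ - y j - x i₀) / (2 * s ^ 2))) Filter.atTop
      (nhds (∑ j, b j * 0)) := by
    refine tendsto_finsetSum _ fun j _ => Filter.Tendsto.const_mul _ ?_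
    refine Real.tendsto_exp_atBot.comp ?_
    refine Filter.Tendsto.atBot_div_const (by positivity) ?_
    refine Filter.Tendsto.const_mul_atTop_of_neg (sub_neg.2 (hi j)) ?_
    simp_rw [sub_sub]
    exact Filter.tendsto_atTop_add_const_right _ _
      (Filter.tendsto_id.const_mul_atTop (by norm_num : (0 : ℝ) < 2))
  simp only [mul_zero, Finset.sum_const_zero] at hlim
  obtain ⟨τ, hτ⟩ := (hlim.eventually (gt_mem_nhds hai)).exists
  refine ⟨τ, ?_⟩
  have hp := gaussianPDFReal_pos (x i₀) _ τ (scaleVar_ne_zero hs)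
  calc ∑ j, b j * gaussianPDFReal (y j) (scaleVar s) τ
      = gaussianPDFReal (x i₀) (scaleVar s) τ * ∑ j, b j *
        Real.exp ((y j - x i₀) * (2 * τ - y j - x i₀) / (2 * s ^ 2)) := by
        rw [Finset.mul_sum]
        refine Finset.sum_congr rfl fun j _ => ?_
        rw [gaussianPDFReal_eq_mul_exp (y j) (x i₀) hs]
        ring
    _ ≤ gaussianPDFReal (x i₀) (scaleVar s) τ * a i₀ := by gcongr
    _ = a i₀ * gaussianPDFReal (x i₀) (scaleVar s) τ := mul_comm _ _
    _ ≤ _ := Finset.single_le_sum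
        (f := fun i => a i * gaussianPDFReal (x i) (scaleVar s) τ)
        (fun i _ => mul_nonneg (ha i) (gaussianPDFReal_nonneg _ _ _)) (Finset.mem_univ i₀)

/-- Each mixture wins on one side: the first far to the right and, by reflection, the second far to
the left. The intermediate value theorem gives a crossing. -/
theorem exists_sum_gaussianPDFReal_eq {ι κ : Type*} [Fintype ι] [Fintype κ] {a : ι → ℝ} {b : κ → ℝ}
    {x : ι → ℝ} {y : κ → ℝ} {s : ℝ} (hs : 0 < s) (ha : ∀ i, 0 ≤ a i) (hb : ∀ j, 0 ≤ b j)
    {i₀ : ι} (hai : 0 < a i₀) (hi : ∀ j, y j < x i₀)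
    {j₀ : κ} (hbj : 0 < b j₀) (hj : ∀ i, y j₀ < x i) :
    ∃ τ, ∑ i, a i * gaussianPDFReal (x i) (scaleVar s) τ =
      ∑ j, b j * gaussianPDFReal (y j) (scaleVar s) τ := by
  obtain ⟨τ₁, h₁⟩ := exists_sum_gaussianPDFReal_le (b := b) hs ha hai hi
  obtain ⟨τ₂, h₂⟩ := exists_sum_gaussianPDFReal_le (b := a) (y := fun i => -x i)
    (x := fun j => -y j) hs hb hbj (fun i => neg_lt_neg (hj i))
  have hcont : ∀ m, Continuous fun τ => gaussianPDFReal m (scaleVar s) τ := fun m => by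
    unfold gaussianPDFReal
    fun_prop
  refine intermediate_value_univ₂
    (continuous_finsetSum _ fun i _ => (hcont _).const_mul _)
    (continuous_finsetSum _ fun j _ => (hcont _).const_mul _) (a := -τ₂) (b := τ₁) ?_ h₁
  simpa only [gaussianPDFReal_neg_arg] using h₂

/-! ### Upper tails -/

/-- The probability that a Gaussian with mean `m` and standard deviation `s` is at least `τ`. -/
def gaussianTail (s τ m : ℝ) : ℝ := (gaussianReal m (scaleVar s)).real (Set.Ici τ)

theorem gaussianTail_nonneg (s τ m : ℝ) : 0 ≤ gaussianTail s τ m := measureReal_nonneg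

theorem gaussianTail_eq (s τ m : ℝ) :
    gaussianTail s τ m = (gaussianReal 0 1).real {ξ | τ ≤ m + s * ξ} := by
  rw [gaussianTail, gaussianReal_eq_map, map_measureReal_apply (by fun_prop) measurableSet_Ici]
  rfl

theorem gaussianTail_mono_of_sub_le {s τ τ' m m' : ℝ} (h : m - τ ≤ m' - τ') :
    gaussianTail s τ m ≤ gaussianTail s τ' m' := by
  rw [gaussianTail_eq, gaussianTail_eq]
  refine measureReal_mono fun ξ hξ => ?_
  simp only [Set.mem_ofPred_eq] at hξ ⊢
  linarith

/-! ### Expectations under the bottom-level sampling schemes -/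

section

variable {T : ℕ}

theorem integral_map_toMeasure {β : Type*} [Fintype β] (p : PMF β)
    (φ : β → Multiset (Fin T)) (f : Multiset (Fin T) → ℝ) :
    ∫ ms, f ms ∂(p.map φ).toMeasure = ∑ b, (p b).toReal * f (φ b) := by
  let _ : MeasurableSpace β := ⊤
  have : DiscreteMeasurableSpace β := ⟨fun _ => trivial⟩
  have hφ : Measurable φ := Measurable.of_discrete
  rw [← PMF.toMeasure_map φ p hφ, integral_map hφ.aemeasurable
    Measurable.of_discrete.aestronglyMeasurable, PMF.integral_eq_sum]
  rfl

/-- The probability of a subset under Poisson sampling with rate `q`. -/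
def subsetProb (q : ℝ) (S : Finset (Fin T)) : ℝ := ∏ t, if t ∈ S then q else 1 - q

variable [NeZero T]

theorem integral_sample_poisson (lam : ℕ) (f : Multiset (Fin T) → ℝ) :
    ∫ ms, f ms ∂(BottomLevel.poisson.sample T lam).toMeasure =
      ∑ S : Finset (Fin T), subsetProb (min 1 ((lam : ℝ) / T)) S * f S.val := by
  rw [BottomLevel.sample, integral_map_toMeasure]
  refine Finset.sum_congr rfl fun S _ => ?_
  congr 1
  rw [poissonSubset, PMF.ofFintype_apply, ENNReal.toReal_prod, subsetProb]
  refine Finset.prod_congr rfl fun t _ => ?_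
  split_ifs
  · rw [ENNReal.coe_toReal]
    push_cast
    rfl
  · rw [ENNReal.toReal_sub_of_le (by exact_mod_cast min_le_left _ _) ENNReal.one_ne_top,
      ENNReal.coe_toReal]
    push_cast
    rfl

theorem integral_sample_withReplacement (lam : ℕ) (f : Multiset (Fin T) → ℝ) :
    ∫ ms, f ms ∂(BottomLevel.withReplacement.sample T lam).toMeasure =
      ∑ ω : Fin lam → Fin T, ((T : ℝ) ^ lam)⁻¹ * f (Finset.univ.val.map ω) := by
  rw [BottomLevel.sample, integral_map_toMeasure]
  refine Finset.sum_congr rfl fun ω _ => ?_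
  congr 1
  simp

/-- The first of several uniform draws is uniform; this embeds the single-draw scheme into the one
with `n + 1` draws. -/
theorem sum_withReplacement_head (n : ℕ) (f : Fin T → ℝ) :
    ∑ ω : Fin (n + 1) → Fin T, ((T : ℝ) ^ (n + 1))⁻¹ * f (ω 0) = ∑ t, (T : ℝ)⁻¹ * f t := by
  rw [← (Fin.consEquiv fun _ : Fin (n + 1) => Fin T).sum_comp, Fintype.sum_prod_type]
  refine Finset.sum_congr rfl fun t _ => ?_
  have hT : (T : ℝ) ≠ 0 := by exact_mod_cast NeZero.ne T
  simp [Fin.consEquiv]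
  field_simp
  ring

theorem integral_sample_withReplacement_one (f : Multiset (Fin T) → ℝ) :
    ∫ ms, f ms ∂(BottomLevel.withReplacement.sample T 1).toMeasure =
      ∑ t, (T : ℝ)⁻¹ * f {t} := by
  rw [integral_sample_withReplacement, ← sum_withReplacement_head 0 fun t => f {t}]
  refine Finset.sum_congr rfl fun ω _ => ?_
  simp

end

/-! ### Monotonicity and resampling of Poisson subsets -/

section

variable {T : ℕ}

/-- Conditioning on whether `a` is included replaces `F S` by an average of `F S` and `F (insert a
S)`. This is again monotone in `S`, and it increases with the rate. -/
theorem sum_powerset_mono_prob {ι : Type*} [DecidableEq ι] (s : Finset ι) {q q' : ℝ} (hq : 0 ≤ q)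
    (hqq : q ≤ q') (hq' : q' ≤ 1) {F : Finset ι → ℝ} (hF : Monotone F) :
    ∑ S ∈ s.powerset, (∏ t ∈ s, if t ∈ S then q else 1 - q) * F S ≤
      ∑ S ∈ s.powerset, (∏ t ∈ s, if t ∈ S then q' else 1 - q') * F S := by
  induction s using Finset.induction_on generalizing F with
  | empty => simp
  | insert a s ha ih =>
    have key : ∀ r : ℝ, ∑ S ∈ (insert a s).powerset,
        (∏ t ∈ insert a s, if t ∈ S then r else 1 - r) * F S =
        ∑ S ∈ s.powerset, (∏ t ∈ s, if t ∈ S then r else 1 - r) *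
          ((1 - r) * F S + r * F (insert a S)) := by
      intro r
      rw [Finset.sum_powerset_insert ha, ← Finset.sum_add_distrib]
      refine Finset.sum_congr rfl fun S hS => ?_
      have haS : a ∉ S := fun h => ha (Finset.mem_powerset.1 hS h)
      rw [Finset.prod_insert ha, Finset.prod_insert ha, if_neg haS,
        if_pos (Finset.mem_insert_self _ _)]
      have : ∏ t ∈ s, (if t ∈ insert a S then r else 1 - r) =
          ∏ t ∈ s, if t ∈ S then r else 1 - r := by
        refine Finset.prod_congr rfl fun t ht => ?_
        have : t ≠ a := fun h => ha (h ▸ ht)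
        simp [this]
      rw [this]
      ring
    rw [key, key]
    refine (ih (F := fun S => (1 - q) * F S + q * F (insert a S)) ?_).trans ?_
    · intro S S' h
      have h1 := hF h
      have h2 := hF (Finset.insert_subset_insert a h)
      have : 0 ≤ 1 - q := by linarith
      dsimp only
      gcongr
    · refine Finset.sum_le_sum fun S _ => mul_le_mul_of_nonneg_left ?_ ?_
      · have := hF (Finset.subset_insert a S)
        nlinarith
      · refine Finset.prod_nonneg fun t _ => ?_
        split_ifs <;> linarith

theorem sum_subsetProb_mono {q q' : ℝ} (hq : 0 ≤ q) (hqq : q ≤ q') (hq' : q' ≤ 1)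
    {F : Finset (Fin T) → ℝ} (hF : Monotone F) :
    ∑ S, subsetProb q S * F S ≤ ∑ S, subsetProb q' S * F S := by
  simpa [subsetProb] using sum_powerset_mono_prob Finset.univ hq hqq hq' hF

theorem subsetProb_nonneg {q : ℝ} (hq : 0 ≤ q) (hq' : q ≤ 1) (S : Finset (Fin T)) :
    0 ≤ subsetProb q S := by
  refine Finset.prod_nonneg fun t _ => ?_
  split_ifs <;> linarith

theorem sum_subsetProb (q : ℝ) : ∑ S : Finset (Fin T), subsetProb q S = 1 := by
  have := Finset.prod_add (fun _ : Fin T => q) (fun _ => 1 - q) Finset.univ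
  simp only [add_sub_cancel, Finset.prod_const_one, Finset.powerset_univ] at this
  rw [this]
  refine Finset.sum_congr rfl fun S _ => ?_
  rw [subsetProb, ← Finset.prod_mul_prod_compl S, ← Finset.compl_eq_univ_sdiff]
  congr 1
  · exact Finset.prod_congr rfl fun t ht => by simp [ht]
  · exact Finset.prod_congr rfl fun t ht => by simp [Finset.mem_compl.mp ht]

/-- The part of a Poisson sample inside of `A` can be replaced by an independent copy. -/
theorem sum_subsetProb_resample (q : ℝ) (A : Finset (Fin T)) (F : Finset (Fin T) → ℝ) :
    ∑ S, subsetProb q S * F S =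
      ∑ V, subsetProb q V * ∑ S, subsetProb q S * F (V \ A ∪ S ∩ A) := by
  have h1 : ∑ S, subsetProb q S * F S =
      ∑ p : Finset (Fin T) × Finset (Fin T), subsetProb q p.1 * subsetProb q p.2 * F p.1 := by
    rw [Fintype.sum_prod_type]
    refine Finset.sum_congr rfl fun S _ => ?_
    dsimp only
    rw [← Finset.sum_mul, ← Finset.mul_sum, sum_subsetProb, mul_one]
  have h2 : ∑ V, subsetProb q V * ∑ S, subsetProb q S * F (V \ A ∪ S ∩ A) =
      ∑ p : Finset (Fin T) × Finset (Fin T), subsetProb q p.1 * subsetProb q p.2 *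
        F (p.1 \ A ∪ p.2 ∩ A) := by
    rw [Fintype.sum_prod_type]
    refine Finset.sum_congr rfl fun S _ => ?_
    rw [Finset.mul_sum]
    exact Finset.sum_congr rfl fun _ _ => by ring
  -- Exchanging the parts of two independent samples inside `A` preserves the product of their
  -- probabilities, index by index.
  have hinv : Function.Involutive fun p : Finset (Fin T) × Finset (Fin T) =>
      (p.1 \ A ∪ p.2 ∩ A, p.2 \ A ∪ p.1 ∩ A) := by
    rintro ⟨S, V⟩
    ext t <;> simp <;> tauto
  rw [h1, h2, ← Equiv.sum_comp hinv.toPerm]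
  refine Finset.sum_congr rfl fun p _ => ?_
  change subsetProb q (p.1 \ A ∪ p.2 ∩ A) * subsetProb q (p.2 \ A ∪ p.1 ∩ A) * _ = _
  congr 1
  simp only [subsetProb, ← Finset.prod_mul_distrib]
  refine Finset.prod_congr rfl fun t _ => ?_
  by_cases h1 : t ∈ p.1 <;> by_cases h2 : t ∈ p.2 <;> by_cases h3 : t ∈ A <;>
    simp [h1, h2, h3, mul_comm]

end

end StructuredSubsampling

namespace StructuredSubsampling

/-! ### Hockey-stick divergence -/

theorem measure_le_hockeyStick_add {O : Type*} [MeasurableSpace O] (α : ℝ≥0) (P Q : Measure O)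
    [IsFiniteMeasure P] [IsFiniteMeasure Q] {A : Set O} (hA : MeasurableSet A) :
    P A ≤ hockeyStick α P Q + α * Q A := by
  have h := congrArg (fun μ => μ A) (P.singularPart_add_rnDeriv Q)
  simp only [Measure.add_apply, withDensity_apply _ hA] at h
  have h1 : ∫⁻ o in A, P.rnDeriv Q o ∂Q ≤ (∫⁻ o, (P.rnDeriv Q o - (α : ℝ≥0∞)) ∂Q) + α * Q A :=
    calc ∫⁻ o in A, P.rnDeriv Q o ∂Q
        ≤ ∫⁻ o in A, ((P.rnDeriv Q o - (α : ℝ≥0∞)) + α) ∂Q :=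
          lintegral_mono fun o => le_tsub_add
      _ = (∫⁻ o in A, (P.rnDeriv Q o - (α : ℝ≥0∞)) ∂Q) + α * Q A := by
          rw [lintegral_add_right _ measurable_const, setLIntegral_const]
      _ ≤ _ := by gcongr; exact Measure.restrict_le_self
  calc P A = P.singularPart Q A + ∫⁻ o in A, P.rnDeriv Q o ∂Q := h.symm
    _ ≤ P.singularPart Q Set.univ +
        ((∫⁻ o, (P.rnDeriv Q o - (α : ℝ≥0∞)) ∂Q) + α * Q A) :=
        add_le_add (measure_mono (Set.subset_univ _)) h1
    _ = _ := by rw [hockeyStick]; ring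

/-- One event attains the divergence: the set `B` where the density exceeds `α`, together with the
`Q`-null set `Nᶜ` that carries the singular part. -/
theorem hockeyStick_le_of_forall {O : Type*} [MeasurableSpace O] {α : ℝ≥0} {P Q : Measure O}
    [IsFiniteMeasure P] [IsFiniteMeasure Q] {c : ℝ≥0∞}
    (h : ∀ A, MeasurableSet A → P A ≤ c + α * Q A) : hockeyStick α P Q ≤ c := by
  obtain ⟨N, hN, hN1, hN2⟩ := Measure.mutuallySingular_singularPart P Q
  have hm := Measure.measurable_rnDeriv P Q
  set B : Set O := {o | (α : ℝ≥0∞) < P.rnDeriv Q o} with hB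
  have hBm : MeasurableSet B := measurableSet_lt measurable_const hm
  have hQB : (α : ℝ≥0∞) * Q B ≠ ∞ := ENNReal.mul_ne_top ENNReal.coe_ne_top (measure_ne_top _ _)
  have hQ : Q (B ∪ Nᶜ) = Q B := by
    refine le_antisymm ((measure_union_le _ _).trans ?_) (measure_mono Set.subset_union_left)
    rw [hN2, add_zero]
  have hA := h (B ∪ Nᶜ) (hBm.union hN.compl)
  rw [hQ] at hA
  have e := congrArg (fun μ => μ (B ∪ Nᶜ)) (P.singularPart_add_rnDeriv Q)
  simp only [Measure.add_apply, withDensity_apply _ (hBm.union hN.compl)] at e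
  have e1 : P.singularPart Q Set.univ ≤ P.singularPart Q (B ∪ Nᶜ) := by
    rw [← Set.union_compl_self N]
    refine (measure_union_le _ _).trans ?_
    rw [hN1, zero_add]
    exact measure_mono Set.subset_union_right
  have e2 : (∫⁻ o, (P.rnDeriv Q o - (α : ℝ≥0∞)) ∂Q) + α * Q B ≤
      ∫⁻ o in B ∪ Nᶜ, P.rnDeriv Q o ∂Q := by
    have : ∫⁻ o, (P.rnDeriv Q o - (α : ℝ≥0∞)) ∂Q = ∫⁻ o in B, (P.rnDeriv Q o - (α : ℝ≥0∞)) ∂Q := by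
      rw [← lintegral_indicator hBm]
      refine lintegral_congr fun o => ?_
      by_cases ho : o ∈ B
      · rw [Set.indicator_of_mem ho]
      · rw [Set.indicator_of_notMem ho]
        exact tsub_eq_zero_of_le (not_lt.1 ho)
    rw [this, ← setLIntegral_const, ← lintegral_add_right _ measurable_const]
    calc ∫⁻ o in B, ((P.rnDeriv Q o - (α : ℝ≥0∞)) + α) ∂Q
        = ∫⁻ o in B, P.rnDeriv Q o ∂Q :=
          setLIntegral_congr_fun hBm fun o ho => tsub_add_cancel_of_le (le_of_lt ho)
      _ ≤ _ := lintegral_mono_set Set.subset_union_left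
  refine (ENNReal.add_le_add_iff_right hQB).1 ?_
  calc hockeyStick α P Q + α * Q B
      = P.singularPart Q Set.univ + ((∫⁻ o, (P.rnDeriv Q o - (α : ℝ≥0∞)) ∂Q) + α * Q B) := by
        rw [hockeyStick]; ring
    _ ≤ P.singularPart Q (B ∪ Nᶜ) + ∫⁻ o in B ∪ Nᶜ, P.rnDeriv Q o ∂Q := add_le_add e1 e2
    _ ≤ _ := e.trans_le hA

/-! ### The difference of a single sequence's contributions -/

section

variable {E : Type*} [NormedAddCommGroup E] [InnerProductSpace ℝ E] [FiniteDimensional ℝ E]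
  [MeasurableSpace E] [BorelSpace E] {T : ℕ}

/-- The gradients along a fixed direction that are extremal for privacy: `c` at the start indices in
`A`, and `k₀` at the other ones. -/
def extremalGrad (A : Finset (Fin T)) (k₀ c : ℝ) (t : Fin T) : ℝ := if t ∈ A then c else k₀

/-- The value of the test "the noisy gradient exceeds `τ`" on the extremal gradients. -/
def extremalValue [NeZero T] (S : BottomLevel) (A : Finset (Fin T)) (α C s k₀ : ℝ) (lam : ℕ)
    (τ : ℝ) : ℝ :=
  ∫ ms, gaussianTail s τ (ms.map (extremalGrad A k₀ C)).sum ∂(S.sample T lam).toMeasure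
    - α * ∫ ms, gaussianTail s τ (ms.map (extremalGrad A k₀ (-C))).sum ∂(S.sample T lam).toMeasure

/-- Sampling more subsequences does not decrease the value of the optimal test. -/
theorem extremalValue_poisson_le [NeZero T] (A : Finset (Fin T)) {α C : ℝ} (s : ℝ) (hα : 0 ≤ α)
    (hC : 0 ≤ C) {lam : ℕ} (hlam : 1 ≤ lam) (τ : ℝ) :
    extremalValue .poisson A α C s 0 1 τ ≤ extremalValue .poisson A α C s 0 lam τ := by
  simp only [extremalValue, integral_sample_poisson]
  have hT : (0 : ℝ) < T := by exact_mod_cast Nat.pos_of_ne_zero (NeZero.ne T)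
  have hq : (0 : ℝ) ≤ min 1 (((1 : ℕ) : ℝ) / T) := by positivity
  have hqq : min 1 (((1 : ℕ) : ℝ) / T) ≤ min 1 ((lam : ℝ) / T) := by gcongr
  -- With `k₀ = 0` all contributions have one sign on each side, so a larger sample raises the sum
  -- on the first side and lowers it on the second.
  have hsum : ∀ (S S' : Finset (Fin T)), S ≤ S' →
      ∑ t ∈ S, extremalGrad A 0 C t ≤ ∑ t ∈ S', extremalGrad A 0 C t := fun S S' h =>
    Finset.sum_le_sum_of_subset_of_nonneg h fun t _ _ => by
      unfold extremalGrad; split_ifs <;> simp [hC]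
  have hneg : ∀ S : Finset (Fin T), ∑ t ∈ S, extremalGrad A 0 (-C) t =
      - ∑ t ∈ S, extremalGrad A 0 C t := fun S => by
    rw [← Finset.sum_neg_distrib]
    exact Finset.sum_congr rfl fun t _ => by unfold extremalGrad; split_ifs <;> simp
  refine sub_le_sub ?_ (mul_le_mul_of_nonneg_left ?_ hα)
  · refine sum_subsetProb_mono hq hqq (min_le_left _ _) fun S S' h => ?_
    exact gaussianTail_mono_of_sub_le (sub_le_sub_right (hsum S S' h) _)
  · have := sum_subsetProb_mono hq hqq (min_le_left _ _)
      (F := fun S => - gaussianTail s τ (∑ t ∈ S, extremalGrad A 0 (-C) t)) fun S S' h => by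
        refine neg_le_neg (gaussianTail_mono_of_sub_le (sub_le_sub_right ?_ _))
        rw [hneg, hneg]
        exact neg_le_neg (hsum S S' h)
    simp only [mul_neg, Finset.sum_neg_distrib] at this
    exact neg_le_neg_iff.1 this

/-- As `|k₀| ≤ C`, each draw after the first contributes at least `k₀` on the first side and at most
`k₀` on the second. Shifting the threshold by `(lam - 1) * k₀` makes both comparisons favorable. -/
theorem extremalValue_withReplacement_le [NeZero T] (A : Finset (Fin T)) {α C k₀ : ℝ} (s : ℝ)
    (hα : 0 ≤ α) (hk : |k₀| ≤ C) {lam : ℕ} (hlam : 1 ≤ lam) (τ : ℝ) :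
    extremalValue .withReplacement A α C s k₀ 1 τ ≤
      extremalValue .withReplacement A α C s k₀ lam (τ + (lam - 1) * k₀) := by
  obtain ⟨n, rfl⟩ := Nat.exists_eq_add_of_le' hlam
  obtain ⟨hk1, hk2⟩ := abs_le.1 hk
  have hsum : ∀ (ω : Fin (n + 1) → Fin T) (c : ℝ),
      ((Finset.univ.val.map ω).map (extremalGrad A k₀ c)).sum =
        extremalGrad A k₀ c (ω 0) + ∑ i : Fin n, extremalGrad A k₀ c (ω i.succ) := by
    intro ω c
    rw [Multiset.map_map, ← Fin.sum_univ_succ fun i => extremalGrad A k₀ c (ω i)]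
    rfl
  have hT : (0 : ℝ) ≤ ((T : ℝ) ^ (n + 1))⁻¹ := by positivity
  have hconst : ∑ _i : Fin n, k₀ = n * k₀ := by simp
  simp only [extremalValue, integral_sample_withReplacement_one, Multiset.map_singleton,
    Multiset.sum_singleton]
  simp only [integral_sample_withReplacement, hsum]
  refine sub_le_sub ?_ (mul_le_mul_of_nonneg_left ?_ hα)
  · rw [← sum_withReplacement_head n fun t => gaussianTail s τ (extremalGrad A k₀ C t)]
    refine Finset.sum_le_sum fun ω _ =>
      mul_le_mul_of_nonneg_left (gaussianTail_mono_of_sub_le ?_) hT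
    have : ∑ _i : Fin n, k₀ ≤ ∑ i : Fin n, extremalGrad A k₀ C (ω i.succ) :=
      Finset.sum_le_sum fun i _ => by unfold extremalGrad; split_ifs <;> simp [hk2]
    rw [hconst] at this
    push_cast
    linarith
  · rw [← sum_withReplacement_head n fun t => gaussianTail s τ (extremalGrad A k₀ (-C) t)]
    refine Finset.sum_le_sum fun ω _ =>
      mul_le_mul_of_nonneg_left (gaussianTail_mono_of_sub_le ?_) hT
    have : ∑ i : Fin n, extremalGrad A k₀ (-C) (ω i.succ) ≤ ∑ _i : Fin n, k₀ :=
      Finset.sum_le_sum fun i _ => by unfold extremalGrad; split_ifs <;> simp [hk1]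
    rw [hconst] at this
    push_cast
    linarith

/-! ### Worst-case gradients for one subsequence per sequence -/

/-- `K` bounds the difference of the noisy sums of gradients on neighboring sequences (with a
single subsequence per sequence), where `A` are the start indices of the subsequences that differ. -/
def BoundsContribution (E : Type*) [NormedAddCommGroup E] [InnerProductSpace ℝ E]
    [FiniteDimensional ℝ E] [MeasurableSpace E] [BorelSpace E] [NeZero T] (S : BottomLevel)
    (A : Finset (Fin T)) (α C s K : ℝ) : Prop :=
  ∀ (g g' : Fin T → E), (∀ t, ‖g t‖ ≤ C) → (∀ t, ‖g' t‖ ≤ C) → (∀ t, t ∉ A → g t = g' t) →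
    ∀ B : Set E, MeasurableSet B →
    ∫ ms, (isoGaussian s (ms.map g).sum).real B ∂(S.sample T 1).toMeasure
      - α * ∫ ms, (isoGaussian s (ms.map g').sum).real B ∂(S.sample T 1).toMeasure ≤ K

/-- Indices outside `A` shift both means equally. The indices inside separate the means of samples
`S` and `S'` by at most `C` per index, which is exactly the gap between `X S` and `-X S'` on the
line. -/
theorem exists_boundsContribution_poisson [NeZero T] {A : Finset (Fin T)} (hA : A.Nonempty)
    {α C s : ℝ} (hα : 0 < α) (hC : 0 < C) (hs : 0 < s) :
    ∃ τ, BoundsContribution E .poisson A α C s (extremalValue .poisson A α C s 0 1 τ) := by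
  have hT : (0 : ℝ) < T := by exact_mod_cast Nat.pos_of_ne_zero (NeZero.ne T)
  set q : ℝ := min 1 (((1 : ℕ) : ℝ) / T) with hq
  have hq0 : 0 < q := by positivity
  have hq1 : q ≤ 1 := min_le_left _ _
  set X : Finset (Fin T) → ℝ := fun S => ∑ t ∈ S, extremalGrad A 0 C t with hX
  have hXi : ∀ S, X S = ∑ t ∈ S ∩ A, C := fun S => by
    simp only [hX, extremalGrad, Finset.sum_ite_mem]
  have hneg : ∀ S : Finset (Fin T), ∑ t ∈ S, extremalGrad A 0 (-C) t = - X S := fun S => by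
    rw [hX, ← Finset.sum_neg_distrib]
    exact Finset.sum_congr rfl fun t _ => by unfold extremalGrad; split_ifs <;> simp
  have hX0 : ∀ S, 0 ≤ X S := fun S => by
    rw [hXi]; exact Finset.sum_nonneg fun _ _ => hC.le
  have hXu : 0 < X Finset.univ := by
    rw [hXi, Finset.univ_inter]; exact Finset.sum_pos (fun _ _ => hC) hA
  have hp0 := subsetProb_nonneg (T := T) hq0.le hq1
  have hpu : 0 < subsetProb q (Finset.univ : Finset (Fin T)) :=
    Finset.prod_pos fun t _ => by simpa using hq0
  obtain ⟨τ, hτ⟩ := exists_sum_gaussianPDFReal_eq (a := subsetProb q)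
    (b := fun S => α * subsetProb q S) (x := X) (y := fun S => - X S) hs hp0
    (fun S => mul_nonneg hα.le (hp0 S)) hpu (fun S => by linarith [hX0 S])
    (mul_pos hα hpu) (fun S => by linarith [hX0 S])
  refine ⟨τ, fun g g' hg hg' hgg B hB => ?_⟩
  simp only [extremalValue, integral_sample_poisson, ← hq]
  change (∑ S, subsetProb q S * (isoGaussian s (∑ t ∈ S, g t)).real B)
    - α * ∑ S, subsetProb q S * (isoGaussian s (∑ t ∈ S, g' t)).real B ≤
    (∑ S, subsetProb q S * gaussianTail s τ (X S))
    - α * ∑ S, subsetProb q S * gaussianTail s τ (∑ t ∈ S, extremalGrad A 0 (-C) t)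
  simp only [hneg]
  -- Both sides share the part `V \ A`, and the mixtures run over the part inside `A` only. Without
  -- this coupling, different samples outside `A` would enlarge the distances.
  rw [sum_subsetProb_resample q A, sum_subsetProb_resample q A
    fun S => (isoGaussian s (∑ t ∈ S, g' t)).real B, Finset.mul_sum, ← Finset.sum_sub_distrib]
  rw [← one_mul ((∑ S, subsetProb q S * gaussianTail s τ (X S)) - _), ← sum_subsetProb (T := T) q,
    Finset.sum_mul]
  refine Finset.sum_le_sum fun V _ => ?_
  rw [mul_left_comm, ← mul_sub]
  refine mul_le_mul_of_nonneg_left ?_ (hp0 V)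
  have hdisj : ∀ S : Finset (Fin T), Disjoint (V \ A) (S ∩ A) := fun S =>
    Finset.disjoint_left.2 fun t h1 h2 => (Finset.mem_sdiff.1 h1).2 (Finset.mem_inter.1 h2).2
  have hV : ∑ t ∈ V \ A, g' t = ∑ t ∈ V \ A, g t :=
    Finset.sum_congr rfl fun t ht => (hgg t (Finset.mem_sdiff.1 ht).2).symm
  simp_rw [Finset.sum_union (hdisj _), hV, Finset.mul_sum, ← mul_assoc]
  refine neymanPearson_mixture hs hp0 (fun S => mul_nonneg hα.le (hp0 S)) hτ (fun S S' => ?_) hB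
  rw [add_sub_add_left_eq_sub, sub_neg_eq_add, hXi, hXi]
  exact (norm_sub_le _ _).trans (add_le_add (norm_sum_le_of_le _ fun t _ => hg t)
    (norm_sum_le_of_le _ fun t _ => hg' t))

/-- Outside `A` both sides have the same mean, so only the net weight `1 - α` matters. It goes to
the first side if positive and to the second, with reversed sign, if negative; this leaves
nonnegative weights. -/
theorem exists_boundsContribution_withReplacement [NeZero T] {A : Finset (Fin T)}
    (hA : A.Nonempty) {α C s : ℝ} (hα : 0 < α) (hC : 0 < C) (hs : 0 < s) :
    ∃ k₀ τ, |k₀| ≤ C ∧ BoundsContribution E .withReplacement A α C s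
      (extremalValue .withReplacement A α C s k₀ 1 τ) := by
  have hT : (0 : ℝ) < T := by exact_mod_cast Nat.pos_of_ne_zero (NeZero.ne T)
  have hT' : (0 : ℝ) < (T : ℝ)⁻¹ := by positivity
  obtain ⟨t₀, ht₀⟩ := hA
  set a : Fin T → ℝ := fun t => (T : ℝ)⁻¹ * if t ∈ A then 1 else max (1 - α) 0 with ha
  set b : Fin T → ℝ := fun t => (T : ℝ)⁻¹ * if t ∈ A then α else max (α - 1) 0 with hb
  have ha0 : ∀ t, 0 ≤ a t := fun t => mul_nonneg hT'.le (by split_ifs <;> simp)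
  have hb0 : ∀ t, 0 ≤ b t := fun t => mul_nonneg hT'.le (by split_ifs <;> simp [hα.le])
  have hat : 0 < a t₀ := by simp [ha, ht₀, hT]
  have hbt : 0 < b t₀ := by simp [hb, ht₀, hT, hα]
  obtain ⟨τ, hτ⟩ := exists_sum_gaussianPDFReal_eq (a := a) (b := b) (x := fun _ => C)
    (y := fun _ => -C) hs ha0 hb0 hat (fun _ => by linarith) hbt (fun _ => by linarith)
  -- `k₀` is the line mean of the side that holds the net weight outside `A`.
  refine ⟨if 1 ≤ α then -C else C, τ, by split_ifs <;> simp [abs_of_pos hC],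
    fun g g' hg hg' hgg B hB => ?_⟩
  simp only [extremalValue, gaussianTail, integral_sample_withReplacement_one,
    Multiset.map_singleton, Multiset.sum_singleton]
  have key := neymanPearson_mixture hs ha0 hb0 hτ (u := g) (w := g') (fun t t' => by
    rw [sub_neg_eq_add]
    exact (norm_sub_le _ _).trans (add_le_add (hg t) (hg' t'))) hB
  rw [Finset.mul_sum, Finset.mul_sum, ← Finset.sum_sub_distrib, ← Finset.sum_sub_distrib]
  rw [← Finset.sum_sub_distrib, ← Finset.sum_sub_distrib] at key
  have hsplit : max (1 - α) 0 - max (α - 1) 0 = 1 - α := by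
    rcases le_total 1 α with h | h
    · rw [max_eq_right (by linarith), max_eq_left (by linarith)]; ring
    · rw [max_eq_left (by linarith), max_eq_right (by linarith)]; ring
  refine (Finset.sum_congr rfl fun t _ => ?_).trans_le (key.trans_eq
    (Finset.sum_congr rfl fun t _ => ?_))
  · by_cases ht : t ∈ A
    · simp only [ha, hb, if_pos ht]; ring
    · simp only [ha, hb, if_neg ht, hgg t ht]
      linear_combination (-(T : ℝ)⁻¹ * (isoGaussian s (g' t)).real B) * hsplit
  · by_cases ht : t ∈ A
    · simp only [ha, hb, if_pos ht, extremalGrad]; ring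
    · simp only [ha, hb, if_neg ht, extremalGrad]
      split_ifs with h
      · rw [max_eq_right (by linarith), max_eq_left (by linarith)]; ring
      · rw [max_eq_left (by linarith), max_eq_right (by linarith)]; ring

/-- There is an extremal instance that bounds the contribution of any pair of neighboring sequences
for a single subsequence, and whose value does not decrease with the number of subsequences. -/
theorem exists_extremalValue [NeZero T] (S : BottomLevel) {A : Finset (Fin T)} (hA : A.Nonempty)
    {α C s : ℝ} (hα : 0 < α) (hC : 0 < C) (hs : 0 < s) {lam : ℕ} (hlam : 1 ≤ lam) :
    ∃ k₀ τ, |k₀| ≤ C ∧ BoundsContribution E S A α C s (extremalValue S A α C s k₀ lam τ) := by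
  cases S with
  | poisson =>
    obtain ⟨τ, h⟩ := exists_boundsContribution_poisson (E := E) hA hα hC hs
    exact ⟨0, τ, by simp [hC.le], fun g g' hg hg' hgg B hB => (h g g' hg hg' hgg B hB).trans
      (extremalValue_poisson_le A s hα.le hC.le hlam τ)⟩
  | withReplacement =>
    obtain ⟨k₀, τ, hk, h⟩ := exists_boundsContribution_withReplacement (E := E) hA hα hC hs
    exact ⟨k₀, _, hk, fun g g' hg hg' hgg B hB => (h g g' hg hg' hgg B hB).trans
      (extremalValue_withReplacement_le A s hα.le hk hlam τ)⟩

end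

end StructuredSubsampling

namespace StructuredSubsampling

/-! ### Measurability -/

theorem ForecastModel.measurable_grad {D LC LF : ℕ} (m : ForecastModel D LC LF)
    (c : Fin LC → ℝ) (y : Fin LF → ℝ) : Measurable fun θ => m.grad θ c y :=
  (InnerProductSpace.toDual ℝ (Params D)).symm.continuous.measurable.comp (measurable_fderiv ℝ _)

theorem measurable_clip {D : ℕ} (C : ℝ) : Measurable (clip C : Params D → Params D) := by
  unfold clip
  fun_prop

theorem norm_clip_le {D : ℕ} {C : ℝ} (hC : 0 < C) (g : Params D) : ‖clip C g‖ ≤ C := by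
  have h1 : (0 : ℝ) < max 1 (‖g‖ / C) := lt_of_lt_of_le one_pos (le_max_left _ _)
  rw [clip, norm_smul, norm_inv, Real.norm_eq_abs, abs_of_pos h1, inv_mul_le_iff₀ h1]
  calc ‖g‖ = ‖g‖ / C * C := by field_simp
    _ ≤ max 1 (‖g‖ / C) * C := by gcongr; exact le_max_right _ _

namespace EpochConfig

variable (cfg : EpochConfig) {lam : ℕ}

/-- The clipped gradient of the subsequence of `a` with start index `t`. -/
def clippedGrad (m : ForecastModel cfg.D cfg.LC cfg.LF) (θ : Params cfg.D) (a : Fin cfg.L → ℝ)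
    (t : Fin cfg.T) : Params cfg.D :=
  clip cfg.C (m.grad θ (contextWindow cfg.LC a t) (forecastWindow cfg.LC cfg.LF a t))

theorem measurable_clippedGrad (m : ForecastModel cfg.D cfg.LC cfg.LF) (a : Fin cfg.L → ℝ)
    (t : Fin cfg.T) : Measurable fun θ => cfg.clippedGrad m θ a t :=
  (measurable_clip _).comp (m.measurable_grad _ _)

theorem noisyGradient_eq (m : ForecastModel cfg.D cfg.LC cfg.LF) (x : Dataset cfg.N cfg.L)
    (b : Fin (cfg.numSteps lam)) (θ : Params cfg.D) (ω : cfg.StepRandomness lam) :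
    cfg.noisyGradient m x b θ ω = (1 / (cfg.batchSize : ℝ)) •
      ((∑ j : Fin (cfg.seqsPerBatch lam),
        ((ω.1 j).map (cfg.clippedGrad m θ (x (cfg.topLevel b j)))).sum)
      + (cfg.σ * cfg.C) • ω.2) := rfl

theorem measurable_noisyGradient (m : ForecastModel cfg.D cfg.LC cfg.LF) (x : Dataset cfg.N cfg.L)
    (b : Fin (cfg.numSteps lam)) :
    Measurable fun p : Params cfg.D × cfg.StepRandomness lam =>
      cfg.noisyGradient m x b p.1 p.2 := by
  have h1 : ∀ a : Fin cfg.L → ℝ, Measurable fun p : Params cfg.D × Multiset (Fin cfg.T) =>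
      (p.2.map (cfg.clippedGrad m p.1 a)).sum := by
    intro a
    -- Multisets of indices are countable and discrete, so one fixed multiset at a time suffices.
    refine measurable_from_prod_countable_left fun ms => ?_
    dsimp only
    induction ms using Multiset.induction_on with
    | empty => simp
    | cons t ms ih =>
      simp only [Multiset.map_cons, Multiset.sum_cons]
      exact (cfg.measurable_clippedGrad m a t).add ih
  have h2 : ∀ j : Fin (cfg.seqsPerBatch lam),
      Measurable fun p : Params cfg.D × cfg.StepRandomness lam =>
        ((p.2.1 j).map (cfg.clippedGrad m p.1 (x (cfg.topLevel b j)))).sum := fun j => by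
    have h3 : Measurable fun p : Params cfg.D × cfg.StepRandomness lam => (p.1, p.2.1 j) :=
      measurable_fst.prodMk ((measurable_pi_apply j).comp (measurable_fst.comp measurable_snd))
    have h4 := (h1 (x (cfg.topLevel b j))).comp h3
    exact h4
  have h4 : Measurable fun p : Params cfg.D × cfg.StepRandomness lam =>
      ∑ j : Fin (cfg.seqsPerBatch lam),
        ((p.2.1 j).map (cfg.clippedGrad m p.1 (x (cfg.topLevel b j)))).sum :=
    Finset.measurable_fun_sum _ fun j _ => h2 j
  have h5 : Measurable fun p : Params cfg.D × cfg.StepRandomness lam =>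
      (cfg.σ * cfg.C) • p.2.2 :=
    (measurable_snd.comp measurable_snd).fun_const_smul _
  simp only [noisyGradient_eq]
  exact (h4.add h5).fun_const_smul _

theorem measurable_noisyGradient_comp (m : ForecastModel cfg.D cfg.LC cfg.LF)
    (x : Dataset cfg.N cfg.L) (b : Fin (cfg.numSteps lam)) {β : Type*} [MeasurableSpace β]
    {θ : β → Params cfg.D} {ω : β → cfg.StepRandomness lam} (hθ : Measurable θ)
    (hω : Measurable ω) : Measurable fun a => cfg.noisyGradient m x b (θ a) (ω a) := by
  have h := (cfg.measurable_noisyGradient m x b).comp (hθ.prodMk hω)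
  exact h

theorem measurable_iterate (m : ForecastModel cfg.D cfg.LC cfg.LF) (x : Dataset cfg.N cfg.L)
    (k : ℕ) : Measurable fun ω : Fin (cfg.numSteps lam) → cfg.StepRandomness lam =>
      cfg.iterate m x ω k := by
  induction k with
  | zero => exact measurable_const
  | succ k ih =>
    simp only [iterate]
    split_ifs with h
    · exact ih.sub ((cfg.measurable_noisyGradient_comp m x ⟨k, h⟩ ih
        (measurable_pi_apply _)).fun_const_smul _)
    · exact ih

theorem measurable_output (m : ForecastModel cfg.D cfg.LC cfg.LF) (x : Dataset cfg.N cfg.L) :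
    Measurable (cfg.output m x (lam := lam)) :=
  measurable_pi_lambda _ fun b => cfg.measurable_noisyGradient_comp m x b
    (cfg.measurable_iterate m x b) (measurable_pi_apply _)

instance (S : BottomLevel) : IsProbabilityMeasure (cfg.stepRandomnessLaw lam S) := by
  unfold stepRandomnessLaw
  infer_instance

instance (S : BottomLevel) (m : ForecastModel cfg.D cfg.LC cfg.LF) (x : Dataset cfg.N cfg.L) :
    IsProbabilityMeasure (cfg.epoch lam S m x) :=
  Measure.isProbabilityMeasure_map (cfg.measurable_output m x).aemeasurable

/-! ### An epoch as a function of the noisy gradient of a single step -/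

/-- The iterates of an epoch in which the noisy gradient of step `b` is replaced by `g`. -/
def forcedIterate (m : ForecastModel cfg.D cfg.LC cfg.LF) (x : Dataset cfg.N cfg.L)
    (b : Fin (cfg.numSteps lam)) (ω : Fin (cfg.numSteps lam) → cfg.StepRandomness lam)
    (g : Params cfg.D) : ℕ → Params cfg.D
  | 0 => cfg.θ₀
  | k + 1 =>
    if h : k < cfg.numSteps lam then
      forcedIterate m x b ω g k - cfg.η • (if (⟨k, h⟩ : Fin (cfg.numSteps lam)) = b then g else
        cfg.noisyGradient m x ⟨k, h⟩ (forcedIterate m x b ω g k) (ω ⟨k, h⟩))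
    else forcedIterate m x b ω g k

/-- The output of an epoch in which the noisy gradient of step `b` is replaced by `g`. -/
def forcedOutput (m : ForecastModel cfg.D cfg.LC cfg.LF) (x : Dataset cfg.N cfg.L)
    (b : Fin (cfg.numSteps lam)) (ω : Fin (cfg.numSteps lam) → cfg.StepRandomness lam)
    (g : Params cfg.D) : Fin (cfg.numSteps lam) → Params cfg.D :=
  fun k => if k = b then g else cfg.noisyGradient m x k (cfg.forcedIterate m x b ω g k) (ω k)

variable (m : ForecastModel cfg.D cfg.LC cfg.LF) {x x' : Dataset cfg.N cfg.L}
  (b : Fin (cfg.numSteps lam)) (ω : Fin (cfg.numSteps lam) → cfg.StepRandomness lam)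

theorem forcedIterate_update (a : cfg.StepRandomness lam) (g : Params cfg.D) (k : ℕ) :
    cfg.forcedIterate m x b (Function.update ω b a) g k = cfg.forcedIterate m x b ω g k := by
  induction k with
  | zero => rfl
  | succ k ih =>
    simp only [forcedIterate, ih]
    split_ifs with h1 h2
    · rfl
    · rw [Function.update_of_ne h2]
    · rfl

theorem forcedIterate_of_le (g g' : Params cfg.D) {k : ℕ} (hk : k ≤ b) :
    cfg.forcedIterate m x b ω g k = cfg.forcedIterate m x b ω g' k := by
  induction k with
  | zero => rfl
  | succ k ih =>
    have h1 : k < cfg.numSteps lam := by omega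
    have h2 : (⟨k, h1⟩ : Fin (cfg.numSteps lam)) ≠ b := fun h => by
      have := congrArg Fin.val h
      simp only at this
      omega
    simp only [forcedIterate, ih (by omega), dif_pos h1, if_neg h2]

theorem iterate_eq_forcedIterate (k : ℕ) :
    cfg.iterate m x ω k = cfg.forcedIterate m x b ω
      (cfg.noisyGradient m x b (cfg.iterate m x ω b) (ω b)) k := by
  induction k with
  | zero => rfl
  | succ k ih =>
    simp only [iterate, forcedIterate, ← ih]
    split_ifs with h1 h2
    · rw [← h2]
    · rfl
    · rfl

/-- The randomness of step `b` enters the output only through that step's noisy gradient, so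
everything later is postprocessing. The forced gradient `0` is a dummy: the iterate entering step
`b` does not depend on it. -/
theorem output_update (a : cfg.StepRandomness lam) :
    cfg.output m x (Function.update ω b a) = cfg.forcedOutput m x b ω
      (cfg.noisyGradient m x b (cfg.forcedIterate m x b ω 0 b) a) := by
  have h := cfg.iterate_eq_forcedIterate m (x := x) b (Function.update ω b a)
  simp only [forcedIterate_update, Function.update_self] at h
  have hb : cfg.iterate m x (Function.update ω b a) b = cfg.forcedIterate m x b ω 0 b := by
    rw [h]
    exact cfg.forcedIterate_of_le m b ω _ _ le_rfl
  rw [hb] at h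
  ext1 k
  simp only [output, forcedOutput]
  split_ifs with hk
  · rw [hk, hb, Function.update_self]
  · rw [h, Function.update_of_ne hk]

theorem forcedIterate_congr
    (hx : ∀ k, k ≠ b → cfg.noisyGradient m x k = cfg.noisyGradient m x' k) (g : Params cfg.D)
    (k : ℕ) : cfg.forcedIterate m x b ω g k = cfg.forcedIterate m x' b ω g k := by
  induction k with
  | zero => rfl
  | succ k ih =>
    simp only [forcedIterate, ih]
    split_ifs with h1 h2
    · rfl
    · rw [hx _ h2]
    · rfl

theorem forcedOutput_congr
    (hx : ∀ k, k ≠ b → cfg.noisyGradient m x k = cfg.noisyGradient m x' k) (g : Params cfg.D) :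
    cfg.forcedOutput m x b ω g = cfg.forcedOutput m x' b ω g := by
  ext1 k
  simp only [forcedOutput, cfg.forcedIterate_congr m b ω hx]
  split_ifs with h
  · rfl
  · rw [hx _ h]

theorem measurable_forcedIterate (k : ℕ) : Measurable fun g => cfg.forcedIterate m x b ω g k := by
  induction k with
  | zero => exact measurable_const
  | succ k ih =>
    simp only [forcedIterate]
    split_ifs with h1 h2
    · exact ih.sub (measurable_id.fun_const_smul _)
    · exact ih.sub ((cfg.measurable_noisyGradient_comp m x ⟨k, h1⟩ ih measurable_const).fun_const_smul _)
    · exact ih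

theorem measurable_forcedOutput : Measurable (cfg.forcedOutput m x b ω) := by
  refine measurable_pi_lambda _ fun k => ?_
  simp only [forcedOutput]
  split_ifs with h
  · exact measurable_id
  · exact cfg.measurable_noisyGradient_comp m x k (cfg.measurable_forcedIterate m b ω k)
      measurable_const


end EpochConfig

/-- Comparison of two events under a product measure, by conditioning on all coordinates but one. -/
theorem measure_pi_le_of_forall_update {ι : Type*} [Fintype ι] [DecidableEq ι] {X : ι → Type*}
    [∀ i, MeasurableSpace (X i)] (μ : ∀ i, Measure (X i)) [∀ i, IsProbabilityMeasure (μ i)]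
    (i : ι) {f f' : (∀ i, X i) → ℝ≥0∞} (hf : Measurable f) (hf' : Measurable f') {c α : ℝ≥0∞}
    (h : ∀ ω, ∫⁻ a, f (Function.update ω i a) ∂μ i ≤
      c + α * ∫⁻ a, f' (Function.update ω i a) ∂μ i) :
    ∫⁻ ω, f ω ∂Measure.pi μ ≤ c + α * ∫⁻ ω, f' ω ∂Measure.pi μ := by
  have hm : Measurable fun ω => c + α * f' ω := (hf'.const_mul _).const_add _
  refine (lintegral_le_of_lmarginal_le {i} hf hm ?_).trans_eq ?_
  · rw [lmarginal_singleton, lmarginal_singleton]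
    intro ω
    have hu : Measurable fun a => f' (Function.update ω i a) := hf'.comp (measurable_update ω)
    dsimp only
    rw [lintegral_add_left measurable_const, lintegral_const_mul _ hu]
    simpa using h ω
  · rw [lintegral_add_left measurable_const, lintegral_const_mul _ hf']
    simp

namespace EpochConfig

variable (cfg : EpochConfig) {lam : ℕ}

/-- Given the other steps' randomness, the same map sends the noisy gradient of step `b` to the
output for `x` and for `x'`. The step bound, uniform in `θ` and in the event, applies to the
preimage of `B` and is then averaged. -/
theorem epoch_le_of_step {S : BottomLevel} {m : ForecastModel cfg.D cfg.LC cfg.LF}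
    {x x' : Dataset cfg.N cfg.L} {b : Fin (cfg.numSteps lam)} {c α : ℝ≥0∞}
    (hx : ∀ k, k ≠ b → cfg.noisyGradient m x k = cfg.noisyGradient m x' k)
    (hb : ∀ θ B, MeasurableSet B → cfg.stepRandomnessLaw lam S {ω | cfg.noisyGradient m x b θ ω ∈ B}
      ≤ c + α * cfg.stepRandomnessLaw lam S {ω | cfg.noisyGradient m x' b θ ω ∈ B})
    {B : Set (Fin (cfg.numSteps lam) → Params cfg.D)} (hB : MeasurableSet B) :
    cfg.epoch lam S m x B ≤ c + α * cfg.epoch lam S m x' B := by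
  have e : ∀ x : Dataset cfg.N cfg.L, cfg.epoch lam S m x B = ∫⁻ ω, (cfg.output m x ⁻¹' B).indicator 1 ω
      ∂(Measure.pi fun _ : Fin (cfg.numSteps lam) => cfg.stepRandomnessLaw lam S) := fun x => by
    rw [epoch, Measure.map_apply (cfg.measurable_output m x) hB,
      lintegral_indicator_one (cfg.measurable_output m x hB)]
  rw [e, e]
  refine measure_pi_le_of_forall_update _ b
    (measurable_one.indicator (cfg.measurable_output m x hB))
    (measurable_one.indicator (cfg.measurable_output m x' hB)) fun ω => ?_
  have e2 : ∀ x : Dataset cfg.N cfg.L, ∫⁻ a, (cfg.output m x ⁻¹' B).indicator 1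
      (Function.update ω b a) ∂(cfg.stepRandomnessLaw lam S) =
      cfg.stepRandomnessLaw lam S {a | cfg.noisyGradient m x b (cfg.forcedIterate m x b ω 0 b) a ∈
        cfg.forcedOutput m x b ω ⁻¹' B} := fun x => by
    rw [← lintegral_indicator_one]
    · refine lintegral_congr fun a => ?_
      classical
      simp only [Set.indicator_apply, Pi.one_apply]
      refine if_congr ?_ rfl rfl
      rw [Set.mem_preimage, output_update]
      rfl
    · exact cfg.measurable_noisyGradient_comp m x b measurable_const measurable_id
        (cfg.measurable_forcedOutput m b ω hB)
  rw [e2, e2, ← cfg.forcedIterate_congr m b ω hx]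
  have : cfg.forcedOutput m x' b ω = cfg.forcedOutput m x b ω := by
    ext1 g; exact (cfg.forcedOutput_congr m b ω hx g).symm
  rw [this]
  exact hb _ _ (cfg.measurable_forcedOutput m b ω hB)

theorem stepRandomnessLaw_noisyGradient (S : BottomLevel) (m : ForecastModel cfg.D cfg.LC cfg.LF)
    (x : Dataset cfg.N cfg.L) (b : Fin (cfg.numSteps lam)) (θ : Params cfg.D)
    {B : Set (Params cfg.D)} (hB : MeasurableSet B) :
    cfg.stepRandomnessLaw lam S {ω | cfg.noisyGradient m x b θ ω ∈ B} =
      ∫⁻ ms, isoGaussian (cfg.σ * cfg.C)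
        (∑ j, ((ms j).map (cfg.clippedGrad m θ (x (cfg.topLevel b j)))).sum)
        ((fun v => (1 / (cfg.batchSize : ℝ)) • v) ⁻¹' B)
        ∂(Measure.pi fun _ : Fin (cfg.seqsPerBatch lam) => (S.sample cfg.T lam).toMeasure) := by
  have hm : MeasurableSet {ω : cfg.StepRandomness lam | cfg.noisyGradient m x b θ ω ∈ B} :=
    cfg.measurable_noisyGradient_comp m x b measurable_const measurable_id hB
  rw [stepRandomnessLaw, Measure.prod_apply hm]
  refine lintegral_congr fun ms => ?_
  rw [isoGaussian, Measure.map_apply (by fun_prop) (measurableSet_preimage (by fun_prop) hB)]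
  rfl

/-! ### Batches and windows affected by the changed entry -/

theorem topLevel_injective {b b' : Fin (cfg.numSteps lam)} {j j' : Fin (cfg.seqsPerBatch lam)}
    (h : cfg.topLevel b j = cfg.topLevel b' j') : b = b' ∧ j = j' := by
  have h1 := congrArg Fin.val h
  simp only [topLevel] at h1
  have hpos : 0 < cfg.seqsPerBatch lam := j.pos
  have e : ∀ (b : Fin (cfg.numSteps lam)) (j : Fin (cfg.seqsPerBatch lam)),
      ((b : ℕ) * cfg.seqsPerBatch lam + j) / cfg.seqsPerBatch lam = b := fun b j => by
    rw [add_comm, Nat.add_mul_div_right _ _ hpos, Nat.div_eq_of_lt j.2, zero_add]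
  have h2 : (b : ℕ) = b' := by rw [← e b j, ← e b' j', h1]
  refine ⟨Fin.ext h2, Fin.ext ?_⟩
  rw [h2] at h1
  omega

/-- The start indices of the subsequences that contain the time step `t₀`. -/
def startsCovering (t₀ : Fin cfg.L) : Finset (Fin cfg.T) :=
  {t | (t : ℕ) ≤ cfg.LC + t₀ ∧ cfg.LC + t₀ < t + cfg.LC + cfg.LF}

theorem startsCovering_nonempty (hLF : 0 < cfg.LF) (hL : cfg.LF ≤ cfg.L) (t₀ : Fin cfg.L) :
    (cfg.startsCovering t₀).Nonempty := by
  have := t₀.2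
  -- This start makes `t₀` the last target entry, or is truncated to the first window if `t₀` comes
  -- too early.
  refine ⟨⟨t₀ + 1 - cfg.LF, by simp only [T, numStarts]; omega⟩, ?_⟩
  simp only [startsCovering, Finset.mem_filter, Finset.mem_univ, true_and]
  omega

theorem prependZeros_congr {L LC : ℕ} {a a' : Fin L → ℝ} {t₀ : Fin L}
    (h : ∀ s, s ≠ t₀ → a s = a' s) {s : ℕ} (hs : s ≠ LC + t₀) :
    prependZeros LC a s = prependZeros LC a' s := by
  unfold prependZeros
  split_ifs with h1
  · refine h _ fun h2 => hs ?_
    have := congrArg Fin.val h2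
    simp only at this
    omega
  · rfl

theorem clippedGrad_congr (m : ForecastModel cfg.D cfg.LC cfg.LF) (θ : Params cfg.D)
    {a a' : Fin cfg.L → ℝ} {t₀ : Fin cfg.L} (h : ∀ s, s ≠ t₀ → a s = a' s) {t : Fin cfg.T}
    (ht : t ∉ cfg.startsCovering t₀) : cfg.clippedGrad m θ a t = cfg.clippedGrad m θ a' t := by
  simp only [startsCovering, Finset.mem_filter, Finset.mem_univ, true_and, not_and, not_lt] at ht
  have h1 : contextWindow cfg.LC a t = contextWindow cfg.LC a' t := by
    ext i
    exact prependZeros_congr h (by omega)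
  have h2 : forecastWindow cfg.LC cfg.LF a t = forecastWindow cfg.LC cfg.LF a' t := by
    ext i
    exact prependZeros_congr h (by omega)
  rw [clippedGrad, clippedGrad, h1, h2]

theorem noisyGradient_congr (m : ForecastModel cfg.D cfg.LC cfg.LF) {x x' : Dataset cfg.N cfg.L}
    {n : Fin cfg.N} (hx : ∀ k, k ≠ n → x k = x' k) {b : Fin (cfg.numSteps lam)}
    (hb : ∀ j, cfg.topLevel b j ≠ n) : cfg.noisyGradient m x b = cfg.noisyGradient m x' b := by
  ext1 θ
  ext1 ω
  simp only [noisyGradient_eq, fun j => hx _ (hb j)]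

end EpochConfig

theorem BoundsContribution.lintegral_le {E : Type*} [NormedAddCommGroup E] [InnerProductSpace ℝ E]
    [FiniteDimensional ℝ E] [MeasurableSpace E] [BorelSpace E] {T : ℕ} [NeZero T] {S : BottomLevel}
    {A : Finset (Fin T)} {α : ℝ≥0} {C s K : ℝ} (h : BoundsContribution E S A α C s K)
    {g g' : Fin T → E} (hg : ∀ t, ‖g t‖ ≤ C) (hg' : ∀ t, ‖g' t‖ ≤ C)
    (hgg : ∀ t, t ∉ A → g t = g' t) {B : Set E} (hB : MeasurableSet B) :
    ∫⁻ ms, isoGaussian s (ms.map g).sum B ∂(S.sample T 1).toMeasure ≤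
      ENNReal.ofReal K + α * ∫⁻ ms, isoGaussian s (ms.map g').sum B ∂(S.sample T 1).toMeasure := by
  have key := h g g' hg hg' hgg B hB
  have hfin : ∀ g : Fin T → E,
      ∫⁻ ms, isoGaussian s (ms.map g).sum B ∂(S.sample T 1).toMeasure ≠ ∞ := fun g =>
    ((lintegral_mono fun ms => prob_le_one).trans_lt (by simp)).ne
  have e : ∀ g : Fin T → E, ∫ ms, (isoGaussian s (ms.map g).sum).real B ∂(S.sample T 1).toMeasure =
      (∫⁻ ms, isoGaussian s (ms.map g).sum B ∂(S.sample T 1).toMeasure).toReal := fun g => by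
    simp only [Measure.real]
    exact integral_toReal Measurable.of_discrete.aemeasurable
      (.of_forall fun ms => measure_lt_top _ _)
  rw [e, e, sub_le_iff_le_add] at key
  calc ∫⁻ ms, isoGaussian s (ms.map g).sum B ∂(S.sample T 1).toMeasure
      = ENNReal.ofReal
          (∫⁻ ms, isoGaussian s (ms.map g).sum B ∂(S.sample T 1).toMeasure).toReal :=
        (ENNReal.ofReal_toReal (hfin g)).symm
    _ ≤ _ := ENNReal.ofReal_le_ofReal key
    _ ≤ _ := ENNReal.ofReal_add_le
    _ = _ := by
      rw [ENNReal.ofReal_mul NNReal.zero_le_coe, ENNReal.ofReal_toReal (hfin g'),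
        ENNReal.ofReal_coe_nnreal]

/-! ### Upper bound for an epoch with one subsequence per sequence -/

namespace EpochConfig

variable (cfg : EpochConfig)

/-- With the samples of the other sequences in the batch frozen, their gradients add the same vector
`r` on both sides. Absorbing `r` into the event leaves the contribution of the changed sequence
alone. -/
theorem step_le_of_boundsContribution {S : BottomLevel} (m : ForecastModel cfg.D cfg.LC cfg.LF)
    {x x' : Dataset cfg.N cfg.L} {n : Fin cfg.N} {t₀ : Fin cfg.L} (hC : 0 < cfg.C)
    (hxn : ∀ s, s ≠ t₀ → x n s = x' n s) (hx : ∀ k, k ≠ n → x k = x' k)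
    {b : Fin (cfg.numSteps 1)} {j₀ : Fin (cfg.seqsPerBatch 1)} (hj : cfg.topLevel b j₀ = n)
    {α : ℝ≥0} {K : ℝ} (hK : BoundsContribution (Params cfg.D) S (cfg.startsCovering t₀) α cfg.C
      (cfg.σ * cfg.C) K) (θ : Params cfg.D) {B : Set (Params cfg.D)} (hB : MeasurableSet B) :
    cfg.stepRandomnessLaw 1 S {ω | cfg.noisyGradient m x b θ ω ∈ B} ≤
      ENNReal.ofReal K + α * cfg.stepRandomnessLaw 1 S {ω | cfg.noisyGradient m x' b θ ω ∈ B} := by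
  rw [cfg.stepRandomnessLaw_noisyGradient S m x b θ hB,
    cfg.stepRandomnessLaw_noisyGradient S m x' b θ hB]
  refine measure_pi_le_of_forall_update _ j₀ Measurable.of_discrete Measurable.of_discrete
    fun ms => ?_
  set r : Params cfg.D := ∑ j ∈ Finset.univ.erase j₀,
    ((ms j).map (cfg.clippedGrad m θ (x (cfg.topLevel b j)))).sum with hr
  have hr' : r = ∑ j ∈ Finset.univ.erase j₀,
      ((ms j).map (cfg.clippedGrad m θ (x' (cfg.topLevel b j)))).sum := by
    refine Finset.sum_congr rfl fun j hj' => ?_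
    rw [hx _ fun h => Finset.ne_of_mem_erase hj' (cfg.topLevel_injective (h.trans hj.symm)).2]
  set B' := (fun v : Params cfg.D => r + v) ⁻¹' ((fun v => (1 / (cfg.batchSize : ℝ)) • v) ⁻¹' B)
    with hB'
  have hBm : MeasurableSet ((fun v : Params cfg.D => (1 / (cfg.batchSize : ℝ)) • v) ⁻¹' B) :=
    measurableSet_preimage (by fun_prop) hB
  have hB'm : MeasurableSet B' := measurableSet_preimage (by fun_prop) hBm
  have e : ∀ y : Dataset cfg.N cfg.L, r = ∑ j ∈ Finset.univ.erase j₀,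
      ((ms j).map (cfg.clippedGrad m θ (y (cfg.topLevel b j)))).sum → ∀ a,
      isoGaussian (cfg.σ * cfg.C) (∑ j, ((Function.update ms j₀ a j).map
        (cfg.clippedGrad m θ (y (cfg.topLevel b j)))).sum)
        ((fun v => (1 / (cfg.batchSize : ℝ)) • v) ⁻¹' B) =
      isoGaussian (cfg.σ * cfg.C) (a.map (cfg.clippedGrad m θ (y n))).sum B' := by
    intro y hy a
    rw [← Finset.add_sum_erase _ _ (Finset.mem_univ j₀), Function.update_self, hj, add_comm,
      isoGaussian, isoGaussian, Measure.map_apply (by fun_prop) hBm,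
      Measure.map_apply (by fun_prop) hB'm]
    have : ∑ j ∈ Finset.univ.erase j₀, ((Function.update ms j₀ a j).map
        (cfg.clippedGrad m θ (y (cfg.topLevel b j)))).sum = r := by
      rw [hy]
      refine Finset.sum_congr rfl fun j hj' => ?_
      rw [Function.update_of_ne (Finset.ne_of_mem_erase hj')]
    rw [this, hB']
    congr 1
    ext z
    simp only [Set.mem_preimage, add_assoc]
  simp only [e x hr, e x' hr']
  exact hK.lintegral_le (fun t => norm_clip_le hC _) (fun t => norm_clip_le hC _)
    (fun t ht => cfg.clippedGrad_congr m θ hxn ht) hB'm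

theorem epoch_one_le_of_boundsContribution {S : BottomLevel}
    (m : ForecastModel cfg.D cfg.LC cfg.LF)
    {x x' : Dataset cfg.N cfg.L} {n : Fin cfg.N} {t₀ : Fin cfg.L} (hC : 0 < cfg.C)
    (hxn : ∀ s, s ≠ t₀ → x n s = x' n s) (hx : ∀ k, k ≠ n → x k = x' k)
    {b : Fin (cfg.numSteps 1)} {j₀ : Fin (cfg.seqsPerBatch 1)} (hj : cfg.topLevel b j₀ = n)
    {α : ℝ≥0} {K : ℝ} (hK : BoundsContribution (Params cfg.D) S (cfg.startsCovering t₀) α cfg.C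
      (cfg.σ * cfg.C) K) :
    hockeyStick α (cfg.epoch 1 S m x) (cfg.epoch 1 S m x') ≤ ENNReal.ofReal K :=
  hockeyStick_le_of_forall fun _ hB => cfg.epoch_le_of_step (b := b)
    (fun _ hk => cfg.noisyGradient_congr m hx fun _ h =>
      hk (cfg.topLevel_injective (h.trans hj.symm)).1)
    (fun θ _ hB => cfg.step_le_of_boundsContribution m hC hxn hx hj hK θ hB) hB

/-- If the changed sequence is not used in the epoch, the output distribution does not change. -/
theorem epoch_congr_of_unused {lam : ℕ} {S : BottomLevel} (m : ForecastModel cfg.D cfg.LC cfg.LF)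
    {x x' : Dataset cfg.N cfg.L} {n : Fin cfg.N} (hx : ∀ k, k ≠ n → x k = x' k)
    (hn : ∀ (b : Fin (cfg.numSteps lam)) (j : Fin (cfg.seqsPerBatch lam)), cfg.topLevel b j ≠ n) :
    cfg.epoch lam S m x = cfg.epoch lam S m x' := by
  have h : ∀ b, cfg.noisyGradient m x b = cfg.noisyGradient m x' b := fun b =>
    cfg.noisyGradient_congr (lam := lam) m hx (hn b)
  have hi : ∀ ω k, cfg.iterate m x ω k = cfg.iterate (lam := lam) m x' ω k := by
    intro ω k
    induction k with
    | zero => rfl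
    | succ k ih => simp only [iterate, ih, h]
  have ho : cfg.output (lam := lam) m x = cfg.output m x' := by
    ext1 ω
    ext1 b
    simp only [output, hi, h]
  rw [epoch, epoch, ho]

end EpochConfig

end StructuredSubsampling

namespace StructuredSubsampling

/-! ### Models with prescribed gradients -/

section

open scoped RealInnerProductSpace

theorem exists_injective_prod_real (n : ℕ) : ∃ f : (Fin n → ℝ) × ℝ → ℝ, Function.Injective f := by
  have h : Cardinal.mk ((Fin n → ℝ) × ℝ) ≤ Cardinal.mk ℝ := by
    have h1 : Cardinal.mk (Fin n → ℝ) ≤ Cardinal.mk ℝ := by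
      rw [← Cardinal.power_def, Cardinal.mk_fin]
      exact_mod_cast Cardinal.power_nat_le (Cardinal.aleph0_le_mk ℝ)
    rw [Cardinal.mk_prod, Cardinal.lift_id, Cardinal.lift_id]
    exact Cardinal.mul_le_of_le (Cardinal.aleph0_le_mk ℝ) h1 le_rfl
  obtain ⟨f⟩ := h
  exact ⟨f, f.injective⟩

theorem hasGradientAt_mul_inner {D : ℕ} (k : ℝ) (e θ : Params D) :
    HasGradientAt (fun θ => k * ⟪e, θ⟫) (k • e) θ := by
  rw [hasGradientAt_iff_hasFDerivAt]
  refine (((innerSL ℝ e).hasFDerivAt (x := θ)).const_mul k).congr_fderiv ?_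
  ext1 v
  simp

/-- The model with loss gradient `wt c y • e` on the context `c` and the target `y`. -/
def weightModel {D LC LF : ℕ} (hLF : 0 < LF) (e : Params D)
    (wt : (Fin LC → ℝ) → (Fin LF → ℝ) → ℝ) : ForecastModel D LC LF where
  -- The loss sees neither the context nor `θ`, so the prediction encodes both the context and `⟪e,
  -- θ⟫` in one real number, which the loss decodes. Only the composite has to be differentiable.
  predict θ c := fun _ => (exists_injective_prod_real LC).choose (c, ⟪e, θ⟫)
  loss ŷ y :=
    let p := Function.invFun (exists_injective_prod_real LC).choose (ŷ ⟨0, hLF⟩)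
    wt p.1 y * p.2
  differentiable c y := by
    simp only [Function.leftInverse_invFun (exists_injective_prod_real LC).choose_spec _]
    exact fun θ => (hasGradientAt_mul_inner _ e θ).differentiableAt

theorem grad_weightModel {D LC LF : ℕ} (hLF : 0 < LF) (e : Params D)
    (wt : (Fin LC → ℝ) → (Fin LF → ℝ) → ℝ) (θ : Params D) (c : Fin LC → ℝ) (y : Fin LF → ℝ) :
    (weightModel hLF e wt).grad θ c y = wt c y • e := by
  simp only [ForecastModel.grad, weightModel,
    Function.leftInverse_invFun (exists_injective_prod_real LC).choose_spec _]
  exact (hasGradientAt_mul_inner _ e θ).gradient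

theorem clip_of_norm_le {D : ℕ} {C : ℝ} (hC : 0 < C) {g : Params D} (hg : ‖g‖ ≤ C) :
    clip C g = g := by
  rw [clip, max_eq_left ((div_le_one hC).2 hg), inv_one, one_smul]

/-! ### The extremal instance -/

/-- The dataset whose `n`-th sequence is constantly `n + 2`, except for the value `v` at the time step
`t₀` of the sequence `n₀`. -/
def spikeDataset {N L : ℕ} (n₀ : Fin N) (t₀ : Fin L) {v : ℝ} (hv : v < 2) : Dataset N L where
  -- Values from `2` upwards identify the sequence and differ from the padding `0` and from the
  -- spikes `±1`.
  toFun n t := if n = n₀ ∧ t = t₀ then v else n + 2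
  inj' := by
    intro n n' h
    have h1 := congrFun h t₀
    have hn : ∀ n : Fin N, (0 : ℝ) ≤ (n : ℕ) := fun n => Nat.cast_nonneg _
    by_cases a : n = n₀ <;> by_cases b : n' = n₀
    · rw [a, b]
    · simp only [a, b, and_true, if_true, if_false] at h1
      linarith [hn n']
    · simp only [a, b, and_true, if_true, if_false] at h1
      linarith [hn n]
    · simp only [a, b, and_true, if_false] at h1
      exact Fin.ext (by exact_mod_cast (add_right_cancel h1))

theorem spikeDataset_apply {N L : ℕ} (n₀ : Fin N) (t₀ : Fin L) {v : ℝ} (hv : v < 2) (n : Fin N)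
    (t : Fin L) : spikeDataset n₀ t₀ hv n t = if n = n₀ ∧ t = t₀ then v else n + 2 := rfl

theorem eventNeighboring_spikeDataset {N L : ℕ} (n₀ : Fin N) (t₀ : Fin L) {v v' : ℝ} (hv : v < 2)
    (hv' : v' < 2) (h : v ≠ v') :
    EventNeighboring (spikeDataset n₀ t₀ hv) (spikeDataset n₀ t₀ hv') := by
  refine ⟨n₀, t₀, by simpa [spikeDataset_apply] using h, fun s hs => ?_, fun m hm => ?_⟩
  · simp [spikeDataset_apply, hs]
  · ext t
    simp [spikeDataset_apply, hm]

theorem prependZeros_spikeDataset_self {N L LC : ℕ} (n₀ : Fin N) (t₀ : Fin L) {v : ℝ}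
    (hv : v < 2) : prependZeros LC (spikeDataset n₀ t₀ hv n₀) (LC + t₀) = v := by
  simp [prependZeros, spikeDataset_apply]

theorem prependZeros_spikeDataset_of_ne {N L LC : ℕ} {n₀ n : Fin N} {t₀ : Fin L} {v : ℝ}
    (hv : v < 2) {s : ℕ} (h : n ≠ n₀ ∨ s ≠ LC + t₀) :
    prependZeros LC (spikeDataset n₀ t₀ hv n) s = 0 ∨
      prependZeros LC (spikeDataset n₀ t₀ hv n) s = n + 2 := by
  unfold prependZeros
  split_ifs with h1
  · right
    rw [spikeDataset_apply, if_neg]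
    rintro ⟨h2, h3⟩
    have h4 := congrArg Fin.val h3
    simp only at h4
    rcases h with h | h
    · exact h h2
    · omega
  · exact Or.inl rfl

/-- The value `r` occurs in a context `c` or a target `y`. -/
def WindowContains {LC LF : ℕ} (r : ℝ) (c : Fin LC → ℝ) (y : Fin LF → ℝ) : Prop :=
  (∃ i, c i = r) ∨ ∃ j, y j = r

open Classical in
/-- Gradients that are extremal for privacy on the datasets `spikeDataset n₀ t₀` with spike `±1`. -/
def spikeWeight {LC LF : ℕ} (hLF : 0 < LF) (n₀ : ℕ) (C k₀ : ℝ) (c : Fin LC → ℝ)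
    (y : Fin LF → ℝ) : ℝ :=
  if WindowContains 1 c y then C
  else if WindowContains (-1) c y then -C
  -- The first target entry is never padding, so in a window without the spike it reveals the
  -- sequence.
  else if y ⟨0, hLF⟩ = n₀ + 2 then k₀ else 0

theorem abs_spikeWeight_le {LC LF : ℕ} (hLF : 0 < LF) (n₀ : ℕ) {C k₀ : ℝ} (hC : 0 < C)
    (hk : |k₀| ≤ C) (c : Fin LC → ℝ) (y : Fin LF → ℝ) : |spikeWeight hLF n₀ C k₀ c y| ≤ C := by
  unfold spikeWeight
  split_ifs <;> simp [abs_of_pos hC, hk, hC.le]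

end

namespace EpochConfig

variable (cfg : EpochConfig) {lam : ℕ}

theorem windowContains_iff {n₀ : Fin cfg.N} {t₀ : Fin cfg.L} {v r : ℝ} (hv : v < 2)
    (hr : r = 1 ∨ r = -1) (n : Fin cfg.N) (t : Fin cfg.T) :
    WindowContains r (contextWindow cfg.LC (spikeDataset n₀ t₀ hv n) t)
      (forecastWindow cfg.LC cfg.LF (spikeDataset n₀ t₀ hv n) t) ↔
      v = r ∧ n = n₀ ∧ t ∈ cfg.startsCovering t₀ := by
  have hn : (0 : ℝ) ≤ (n : ℕ) := Nat.cast_nonneg _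
  have hval : ∀ s, prependZeros cfg.LC (spikeDataset n₀ t₀ hv n) s = r →
      n = n₀ ∧ s = cfg.LC + t₀ := by
    intro s hs
    by_contra hcon
    rw [not_and_or] at hcon
    rcases prependZeros_spikeDataset_of_ne hv hcon with h | h <;> rw [h] at hs <;>
      rcases hr with rfl | rfl <;> linarith
  simp only [startsCovering, Finset.mem_filter, Finset.mem_univ, true_and]
  constructor
  · rintro (⟨i, hi⟩ | ⟨j, hj⟩)
    · obtain ⟨h1, h2⟩ := hval _ hi
      refine ⟨?_, h1, by omega, by omega⟩
      rw [contextWindow, h1, h2, prependZeros_spikeDataset_self] at hi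
      exact hi
    · obtain ⟨h1, h2⟩ := hval _ hj
      refine ⟨?_, h1, by omega, by omega⟩
      rw [forecastWindow, h1, h2, prependZeros_spikeDataset_self] at hj
      exact hj
  · rintro ⟨rfl, rfl, h1, h2⟩
    by_cases h3 : cfg.LC + t₀ < t + cfg.LC
    · refine Or.inl ⟨⟨cfg.LC + t₀ - t, by omega⟩, ?_⟩
      rw [contextWindow, show (t : ℕ) + (cfg.LC + t₀ - t) = cfg.LC + t₀ by omega,
        prependZeros_spikeDataset_self]
    · refine Or.inr ⟨⟨cfg.LC + t₀ - (t + cfg.LC), by omega⟩, ?_⟩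
      rw [forecastWindow,
        show (t : ℕ) + cfg.LC + (cfg.LC + t₀ - (t + cfg.LC)) = cfg.LC + t₀ by omega,
        prependZeros_spikeDataset_self]

theorem spikeWeight_spikeDataset (hLF : 0 < cfg.LF) (hL : cfg.LF ≤ cfg.L) (n₀ : Fin cfg.N)
    (t₀ : Fin cfg.L) (C k₀ : ℝ) {v : ℝ} (hv : v < 2) (hv1 : v = 1 ∨ v = -1) (n : Fin cfg.N)
    (t : Fin cfg.T) :
    spikeWeight hLF n₀ C k₀ (contextWindow cfg.LC (spikeDataset n₀ t₀ hv n) t)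
      (forecastWindow cfg.LC cfg.LF (spikeDataset n₀ t₀ hv n) t) =
      if n = n₀ then extremalGrad (cfg.startsCovering t₀) k₀ (v * C) t else 0 := by
  simp only [spikeWeight, cfg.windowContains_iff hv (Or.inl rfl),
    cfg.windowContains_iff hv (Or.inr rfl), extremalGrad]
  have hfirst : ¬ (n = n₀ ∧ t ∈ cfg.startsCovering t₀) →
      forecastWindow cfg.LC cfg.LF (spikeDataset n₀ t₀ hv n) t ⟨0, hLF⟩ = n + 2 := by
    intro h
    have ht := t.2
    simp only [T, numStarts] at ht
    rw [forecastWindow, prependZeros, dif_pos (by constructor <;> simp; omega),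
      spikeDataset_apply, if_neg]
    rintro ⟨h1, h2⟩
    refine h ⟨h1, ?_⟩
    have := congrArg Fin.val h2
    simp only [add_zero] at this
    simp only [startsCovering, Finset.mem_filter, Finset.mem_univ, true_and]
    omega
  by_cases h1 : n = n₀
  · by_cases h2 : t ∈ cfg.startsCovering t₀
    · rcases hv1 with rfl | rfl
      · simp [h1, h2]
      · have : (-1 : ℝ) ≠ 1 := by norm_num
        simp [h1, h2, this]
    · simp [h2, hfirst (fun h => h2 h.2)]
      simp [h1]
  · rw [hfirst fun h => h1 h.1]
    have : ((n : ℕ) : ℝ) ≠ (n₀ : ℕ) := fun h => h1 (Fin.ext (by exact_mod_cast h))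
    simp [h1, this]

/-- The model of the extremal instance. -/
def spikeModel (hLF : 0 < cfg.LF) (e : Params cfg.D) (n₀ : Fin cfg.N) (k₀ : ℝ) :
    ForecastModel cfg.D cfg.LC cfg.LF :=
  weightModel hLF e (spikeWeight hLF n₀ cfg.C k₀)

theorem clippedGrad_spikeModel (hLF : 0 < cfg.LF) (hL : cfg.LF ≤ cfg.L) (hC : 0 < cfg.C)
    {e : Params cfg.D} (he : ‖e‖ = 1) (n₀ : Fin cfg.N) (t₀ : Fin cfg.L) {k₀ : ℝ}
    (hk : |k₀| ≤ cfg.C) {v : ℝ} (hv : v < 2) (hv1 : v = 1 ∨ v = -1) (θ : Params cfg.D)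
    (n : Fin cfg.N) (t : Fin cfg.T) :
    cfg.clippedGrad (cfg.spikeModel hLF e n₀ k₀) θ (spikeDataset n₀ t₀ hv n) t =
      (if n = n₀ then extremalGrad (cfg.startsCovering t₀) k₀ (v * cfg.C) t else 0) • e := by
  rw [clippedGrad, spikeModel, grad_weightModel, clip_of_norm_le hC,
    cfg.spikeWeight_spikeDataset hLF hL _ _ _ _ hv hv1]
  rw [norm_smul, he, mul_one]
  exact abs_spikeWeight_le hLF _ hC hk _ _

open scoped RealInnerProductSpace

theorem isoGaussian_halfspace {E : Type*} [NormedAddCommGroup E] [InnerProductSpace ℝ E]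
    [FiniteDimensional ℝ E] [MeasurableSpace E] [BorelSpace E] {e : E} (he : ‖e‖ = 1)
    (s τ k : ℝ) : isoGaussian s (k • e) {v | τ ≤ ⟪v, e⟫} = ENNReal.ofReal (gaussianTail s τ k) := by
  have hm : MeasurableSet {v : E | τ ≤ ⟪v, e⟫} := measurableSet_le measurable_const (by fun_prop)
  have hm' : MeasurableSet {ξ : ℝ | τ ≤ k + s * ξ} := measurableSet_le measurable_const (by fun_prop)
  rw [isoGaussian, Measure.map_apply (by fun_prop) hm, gaussianTail_eq, ofReal_measureReal,
    ← map_inner_stdGaussian he, Measure.map_apply (by fun_prop) hm']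
  congr 1
  ext z
  simp [inner_add_left, real_inner_smul_left, he]

theorem sum_contributions_spikeModel (hLF : 0 < cfg.LF) (hL : cfg.LF ≤ cfg.L) (hC : 0 < cfg.C)
    {e : Params cfg.D} (he : ‖e‖ = 1) (t₀ : Fin cfg.L) {k₀ : ℝ}
    (hk : |k₀| ≤ cfg.C) {v : ℝ} (hv : v < 2) (hv1 : v = 1 ∨ v = -1)
    (b : Fin (cfg.numSteps lam)) (j₀ : Fin (cfg.seqsPerBatch lam)) (θ : Params cfg.D)
    (ms : Fin (cfg.seqsPerBatch lam) → Multiset (Fin cfg.T)) :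
    ∑ j, ((ms j).map (cfg.clippedGrad (cfg.spikeModel hLF e (cfg.topLevel b j₀) k₀) θ
      (spikeDataset (cfg.topLevel b j₀) t₀ hv (cfg.topLevel b j)))).sum =
      ((ms j₀).map (extremalGrad (cfg.startsCovering t₀) k₀ (v * cfg.C))).sum • e := by
  rw [Finset.sum_eq_single j₀]
  · rw [Multiset.sum_smul, Multiset.map_map]
    congr 1
    refine Multiset.map_congr rfl fun t _ => ?_
    rw [cfg.clippedGrad_spikeModel hLF hL hC he _ _ hk hv hv1, if_pos rfl]
    rfl
  · intro j _ hj
    have : cfg.topLevel b j ≠ cfg.topLevel b j₀ := fun h => hj (cfg.topLevel_injective h).2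
    refine Multiset.sum_eq_zero fun g hg => ?_
    obtain ⟨t, _, rfl⟩ := Multiset.mem_map.1 hg
    rw [cfg.clippedGrad_spikeModel hLF hL hC he _ _ hk hv hv1, if_neg this, zero_smul]
  · simp

/-- The event concerns only the first noisy gradient, and in that batch every other sequence has
zero gradient. The threshold is divided by the batch size because the noisy gradient is. -/
theorem epoch_spikeModel_apply (S : BottomLevel) (hLF : 0 < cfg.LF) (hL : cfg.LF ≤ cfg.L)
    (hΛ : 0 < cfg.batchSize) (hC : 0 < cfg.C) {e : Params cfg.D} (he : ‖e‖ = 1)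
    (t₀ : Fin cfg.L) {k₀ : ℝ}
    (hk : |k₀| ≤ cfg.C) {v : ℝ} (hv : v < 2) (hv1 : v = 1 ∨ v = -1)
    (hb : 0 < cfg.numSteps lam) (j₀ : Fin (cfg.seqsPerBatch lam)) (τ : ℝ) :
    cfg.epoch lam S (cfg.spikeModel hLF e (cfg.topLevel ⟨0, hb⟩ j₀) k₀)
      (spikeDataset (cfg.topLevel ⟨0, hb⟩ j₀) t₀ hv)
      {o | τ / cfg.batchSize ≤ ⟪o ⟨0, hb⟩, e⟫} =
      ENNReal.ofReal (∫ ms, gaussianTail (cfg.σ * cfg.C) τ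
        (ms.map (extremalGrad (cfg.startsCovering t₀) k₀ (v * cfg.C))).sum
          ∂(S.sample cfg.T lam).toMeasure) := by
  set m := cfg.spikeModel hLF e (cfg.topLevel ⟨0, hb⟩ j₀) k₀ with hm
  set x := spikeDataset (cfg.topLevel ⟨0, hb⟩ j₀) t₀ hv with hx
  set B : Set (Params cfg.D) := {v | τ / cfg.batchSize ≤ ⟪v, e⟫} with hB
  have hBm : MeasurableSet B := measurableSet_le measurable_const (by fun_prop)
  have hΛ' : (0 : ℝ) < cfg.batchSize := by exact_mod_cast hΛ
  have hBs : (fun v : Params cfg.D => (1 / (cfg.batchSize : ℝ)) • v) ⁻¹' B = {v | τ ≤ ⟪v, e⟫} := by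
    ext v
    simp only [hB, Set.mem_preimage, Set.mem_ofPred_eq, real_inner_smul_left]
    rw [one_div, ← div_eq_inv_mul, div_le_div_iff_of_pos_right hΛ']
  have hEm : MeasurableSet {o : Fin (cfg.numSteps lam) → Params cfg.D |
      τ / cfg.batchSize ≤ ⟪o ⟨0, hb⟩, e⟫} := 
    measurableSet_le measurable_const (Measurable.inner (by fun_prop) measurable_const)
  have hpre : cfg.output m x (lam := lam) ⁻¹' {o | τ / cfg.batchSize ≤ ⟪o ⟨0, hb⟩, e⟫} =
      Function.eval ⟨0, hb⟩ ⁻¹' {ω | cfg.noisyGradient m x ⟨0, hb⟩ cfg.θ₀ ω ∈ B} := rfl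
  have hSm : MeasurableSet {ω : cfg.StepRandomness lam |
      cfg.noisyGradient m x ⟨0, hb⟩ cfg.θ₀ ω ∈ B} :=
    cfg.measurable_noisyGradient_comp m x _ measurable_const measurable_id hBm
  rw [epoch, Measure.map_apply (cfg.measurable_output m x) hEm, hpre,
    (measurePreserving_eval (fun _ : Fin (cfg.numSteps lam) => cfg.stepRandomnessLaw lam S)
      ⟨0, hb⟩).measure_preimage hSm.nullMeasurableSet,
    cfg.stepRandomnessLaw_noisyGradient S m x _ _ hBm, hBs]
  simp only [hm, hx, cfg.sum_contributions_spikeModel hLF hL hC he t₀ hk hv hv1,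
    isoGaussian_halfspace he]
  rw [ofReal_integral_eq_lintegral_ofReal]
  · exact (measurePreserving_eval (fun _ : Fin (cfg.seqsPerBatch lam) =>
      (S.sample cfg.T lam).toMeasure) j₀).lintegral_comp (f := fun ms =>
        ENNReal.ofReal (gaussianTail (cfg.σ * cfg.C) τ
        (ms.map (extremalGrad (cfg.startsCovering t₀) k₀ (v * cfg.C))).sum))
      Measurable.of_discrete
  · refine Integrable.of_bound (C := 1) Measurable.of_discrete.aestronglyMeasurable
      (.of_forall fun ms => ?_)
    rw [Real.norm_eq_abs, gaussianTail, abs_of_nonneg measureReal_nonneg]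
    exact measureReal_le_one
  · exact .of_forall fun ms => measureReal_nonneg

/-! ### Lower bounds on the privacy profile and the comparison -/

theorem extremalValue_le_privacyProfile (S : BottomLevel) (hLF : 0 < cfg.LF) (hL : cfg.LF ≤ cfg.L)
    (hΛ : 0 < cfg.batchSize) (hC : 0 < cfg.C) {e : Params cfg.D} (he : ‖e‖ = 1)
    (t₀ : Fin cfg.L) {k₀ : ℝ} (hk : |k₀| ≤ cfg.C) (hb : 0 < cfg.numSteps lam)
    (j₀ : Fin (cfg.seqsPerBatch lam)) (α : ℝ≥0) (τ : ℝ) :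
    ENNReal.ofReal (extremalValue S (cfg.startsCovering t₀) α cfg.C (cfg.σ * cfg.C) k₀ lam τ) ≤
      privacyProfile (cfg.epoch lam S) EventNeighboring α := by
  have hv : (1 : ℝ) < 2 := by norm_num
  have hv' : (-1 : ℝ) < 2 := by norm_num
  have hEm : MeasurableSet {o : Fin (cfg.numSteps lam) → Params cfg.D |
      τ / cfg.batchSize ≤ ⟪o ⟨0, hb⟩, e⟫} :=
    measurableSet_le measurable_const (Measurable.inner (by fun_prop) measurable_const)
  set n₀ := cfg.topLevel ⟨0, hb⟩ j₀ with hn₀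
  have h := measure_le_hockeyStick_add α
    (cfg.epoch lam S (cfg.spikeModel hLF e n₀ k₀) (spikeDataset n₀ t₀ hv))
    (cfg.epoch lam S (cfg.spikeModel hLF e n₀ k₀) (spikeDataset n₀ t₀ hv')) hEm
  rw [hn₀, cfg.epoch_spikeModel_apply S hLF hL hΛ hC he t₀ hk hv (Or.inl rfl) hb j₀ τ,
    cfg.epoch_spikeModel_apply S hLF hL hΛ hC he t₀ hk hv' (Or.inr rfl) hb j₀ τ, one_mul,
    neg_one_mul] at h
  rw [extremalValue, ENNReal.ofReal_sub _ (mul_nonneg NNReal.zero_le_coe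
    (integral_nonneg fun ms => gaussianTail_nonneg _ _ _)), ENNReal.ofReal_mul NNReal.zero_le_coe,
    ENNReal.ofReal_coe_nnreal]
  refine (tsub_le_iff_right.2 ?_).trans
    (le_iSup_of_le (cfg.spikeModel hLF e n₀ k₀) (le_iSup_of_le (spikeDataset n₀ t₀ hv)
      (le_iSup_of_le (spikeDataset n₀ t₀ hv') (le_iSup_of_le
        (eventNeighboring_spikeDataset n₀ t₀ hv hv' (by norm_num)) le_rfl))))
  exact h

/-- The whole space serves as the event. With `hockeyStick_self_le` this settles every case in which
the two outputs have the same distribution. -/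
theorem one_sub_le_privacyProfile (S : BottomLevel) {x x' : Dataset cfg.N cfg.L}
    (hx : EventNeighboring x x') (m : ForecastModel cfg.D cfg.LC cfg.LF) (α : ℝ≥0) :
    1 - (α : ℝ≥0∞) ≤ privacyProfile (cfg.epoch lam S) EventNeighboring α := by
  have h := measure_le_hockeyStick_add α (cfg.epoch lam S m x) (cfg.epoch lam S m x')
    MeasurableSet.univ
  rw [measure_univ, measure_univ, mul_one] at h
  exact (tsub_le_iff_right.2 h).trans
    (le_iSup_of_le m (le_iSup_of_le x (le_iSup_of_le x' (le_iSup_of_le hx le_rfl))))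

theorem hockeyStick_self_le {O : Type*} [MeasurableSpace O] (α : ℝ≥0) (P : Measure O)
    [IsProbabilityMeasure P] : hockeyStick α P P ≤ 1 - (α : ℝ≥0∞) := by
  refine hockeyStick_le_of_forall fun B _ => ?_
  calc P B = 1 * P B := (one_mul _).symm
    _ ≤ ((1 - (α : ℝ≥0∞)) + α) * P B := by gcongr; exact le_tsub_add
    _ = (1 - (α : ℝ≥0∞)) * P B + α * P B := add_mul _ _ _
    _ ≤ _ := by
      gcongr
      exact mul_le_of_le_one_right (zero_le) prob_le_one

/-- Sampling one subsequence per sequence is the most private choice. -/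
theorem privacyProfile_one_le (S : BottomLevel) (hLF : 0 < cfg.LF) (hL : cfg.LF ≤ cfg.L)
    (hσ : 0 < cfg.σ) (hC : 0 < cfg.C) (hlam : 1 ≤ lam) (hlam' : lam ≤ cfg.batchSize) (α : ℝ≥0) :
    privacyProfile (cfg.epoch 1 S) EventNeighboring α ≤
      privacyProfile (cfg.epoch lam S) EventNeighboring α := by
  refine iSup_le fun m => iSup_le fun x => iSup_le fun x' => iSup_le fun hx => ?_
  have hmin := cfg.one_sub_le_privacyProfile (lam := lam) S hx m α
  obtain ⟨n, t₀, -, hxn, hxm⟩ := hx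
  -- At `α = 0` the second mixture has no weight and no balancing threshold need exist, but the
  -- trivial bound `1` is already attained.
  rcases eq_or_ne α 0 with rfl | hα
  · refine le_trans (hockeyStick_le_of_forall fun B _ => ?_) hmin
    simpa using prob_le_one
  have hα' : (0 : ℝ) < α := NNReal.coe_pos.2 (pos_iff_ne_zero.2 hα)
  by_cases hn : ∀ (b : Fin (cfg.numSteps 1)) (j : Fin (cfg.seqsPerBatch 1)), cfg.topLevel b j ≠ n
  · rw [cfg.epoch_congr_of_unused m (fun k hk => hxm k hk) hn]
    exact (hockeyStick_self_le α _).trans hmin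
  push Not at hn
  obtain ⟨b, j, hbj⟩ := hn
  -- Without parameters there is no unit vector to carry the extremal gradients, but all outputs
  -- coincide.
  rcases Nat.eq_zero_or_pos cfg.D with hD | hD
  · have : IsEmpty (Fin cfg.D) := by rw [hD]; infer_instance
    have hs : Subsingleton (Fin (cfg.numSteps 1) → Params cfg.D) := inferInstance
    have : cfg.epoch 1 S m x = cfg.epoch 1 S m x' := by
      rw [epoch, epoch]
      congr 1
      ext1 ω
      exact Subsingleton.elim _ _
    rw [this]
    exact (hockeyStick_self_le α _).trans hmin
  obtain ⟨k₀, τ, hk, hK⟩ := exists_extremalValue (E := Params cfg.D) S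
    (cfg.startsCovering_nonempty hLF hL t₀) hα' hC (mul_pos hσ hC) hlam
  refine (cfg.epoch_one_le_of_boundsContribution m hC hxn hxm hbj hK).trans ?_
  -- The number of steps does not decrease with `lam`, and step `b` exists for one subsequence per
  -- sequence.
  have hb : 0 < cfg.numSteps lam := by
    refine lt_of_lt_of_le b.pos (Nat.div_le_div_right ?_)
    exact Nat.mul_le_mul_left _ hlam
  have hj : 0 < cfg.seqsPerBatch lam := Nat.div_pos hlam' hlam
  exact cfg.extremalValue_le_privacyProfile S hLF hL (hlam.trans hlam') hC
    (e := EuclideanSpace.single ⟨0, hD⟩ 1) (by simp) t₀ hk hb ⟨0, hj⟩ α τ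

end EpochConfig

end StructuredSubsampling

end

open StructuredSubsampling in
theorem theorem4p1 (cfg : EpochConfig) (S : BottomLevel)
    (hLC : 0 < cfg.LC) (hLF : 0 < cfg.LF) (hL : cfg.LC + cfg.LF + cfg.LF ≤ cfg.L + 1)
    (hΛ : 0 < cfg.batchSize) (hσ : 0 < cfg.σ) (hC : 0 < cfg.C) (hη : 0 < cfg.η)
    {Ω : ℕ → Type*} [∀ lam, MeasurableSpace (Ω lam)] (P Q : ∀ lam, Measure (Ω lam))
    (hPQ : ∀ lam ∈ Set.Icc 1 cfg.batchSize,
      IsTightDominatingPair (cfg.epoch lam S) EventNeighboring (P lam) (Q lam)) :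
    ∀ α : ℝ≥0,
      IsMinOn (fun lam => hockeyStick α (P lam) (Q lam)) (Set.Icc 1 cfg.batchSize) 1 := by
  intro α lam hlam
  have h1 := (hPQ 1 ⟨le_rfl, hΛ⟩).2.2 α
  have h2 := (hPQ lam hlam).2.2 α
  change hockeyStick α (P 1) (Q 1) ≤ hockeyStick α (P lam) (Q lam)
  rw [← h1, ← h2]
  exact cfg.privacyProfile_one_le S hLF (by omega) hσ hC hlam.1 hlam.2 α
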